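/- A knot is the image of a smooth embedding of a circle in $S^3$. For a knot $k$ choose a closed smooth tubular neighbourhood $V\cong k\times D^2$ of $k$ and a base point $*\in\partial V$; the group of $k$ is $\pi k=\pi_1(S^3\setminus \operatorname{int}V,*)$, and its peripheral subgroup $\langle m,l\rangle$, generated by a meridian and a longitude, is the image of $\pi_1(\partial V,*)$ in $\pi k$. For knots $k_1,k_2$ with peripheral subgroups $\langle m_1,l_1\rangle$ and $\langle m_2,l_2\rangle$, write $k_1\succeq k_2$ if there is an epimorphism $\pi k_1\to\pi k_2$ that maps $\langle m_1,l_1\rangle$ onto a conjugate of a subgroup of $\langle m_2,l_2\rangle$ (this does not depend on the tubular neighbourhoods and base points; it is asserted for all choices of them). A longitude of a solid torus $V\subset S^3$ is an essential simple closed curve in $\partial V$ that is null-homologous in $S^3\setminus\operatorname{int}V$. A knot $k$ is a satellite knot with pattern knot $\tilde k$ if there are a standard (unknotted) solid torus $\tilde V\subset S^3$ whose interior contains $\tilde k$, such that $\tilde k$ is not contained in any $3$-ball in $\tilde V$, a tubular neighbourhood $\hat V\subset S^3$ of some knot $\hat k$ (the companion), and a diffeomorphism $g:\tilde V\to\hat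 V$ that sends a longitude of $\tilde V$ to a longitude of $\hat V$, with $g(\tilde k)=k$. **Proposition 3.4.** If $k$ is a satellite knot with pattern knot $\tilde k$, then $k\succeq\tilde k$. -/

import Mathlib

open Set Metric
open scoped Manifold ContDiff

/-- The unit 3-sphere in `ℝ⁴`, with Mathlib's smooth structure (modelled on `𝓡 3`). -/
abbrev S3 : Type := sphere (0 : EuclideanSpace ℝ (Fin 4)) 1

instance instFactFinrankFour : Fact (Module.finrank ℝ (EuclideanSpace ℝ (Fin 4)) = 3 + 1) :=
  ⟨by simp⟩

/-- A knot: the image of a smooth embedding of a circle in the 3-sphere. -/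
structure Knot where
  carrier : Set S3
  exists_embedding : ∃ f : Circle → S3,
    Manifold.IsSmoothEmbedding (𝓡 1) (𝓡 3) ∞ f ∧ range f = carrier

/-- `V` is a (closed, smooth) tubular neighbourhood of `K`. The parametrization `τ` is a smooth
open embedding of `S¹ × ℝ²` (an injective local diffeomorphism); it carries `S¹ × D²` onto `V` and
`S¹ × {0}` onto `K`. -/
def IsTubularNhd (V K : Set S3) : Prop :=
  ∃ τ : Circle × ℂ → S3, Function.Injective τ ∧
    IsLocalDiffeomorph ((𝓡 1).prod 𝓘(ℝ, ℂ)) (𝓡 3) ∞ τ ∧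
    τ '' {p | ‖p.2‖ ≤ 1} = V ∧ τ '' {p | p.2 = 0} = K

/-- `B` is a smoothly embedded closed 3-ball in the 3-sphere. -/
def IsThreeBall (B : Set S3) : Prop :=
  ∃ β : EuclideanSpace ℝ (Fin 3) → S3, Function.Injective β ∧
    IsLocalDiffeomorph (𝓡 3) (𝓡 3) ∞ β ∧ β '' closedBall 0 1 = B

/-! ### Exteriors, knot groups and peripheral subgroups -/

/-- The exterior `S³ \ int V`. -/
abbrev Exterior (V : Set S3) : Type := ↥((interior V)ᶜ)

/-- The inclusion of the boundary `∂V` into the exterior `S³ \ int V`. -/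
def boundaryInclusion (V : Set S3) : C(↥(frontier V), Exterior V) where
  toFun x := ⟨x.1, fun hx => x.2.2 hx⟩
  continuous_toFun := by fun_prop

/-- The knot group `π₁(S³ \ int V, x)`, formed with a tubular neighbourhood `V` of the knot and a
base point `x` on `∂V`. -/
abbrev KnotGroup (V : Set S3) (x : ↥(frontier V)) : Type :=
  FundamentalGroup (Exterior V) (boundaryInclusion V x)

/-- The peripheral subgroup: the image of `π₁(∂V, x)` in the knot group. As a meridian and a
longitude generate the fundamental group of the torus `∂V`, this is the subgroup `⟨m, l⟩`. -/
noncomputable def peripheralSubgroup (V : Set S3) (x : ↥(frontier V)) : Subgroup (KnotGroup V x) :=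
  (FundamentalGroup.map (boundaryInclusion V) x).range

/-- A homomorphism `φ : G₁ → G₂` carries the subgroup `P₁` onto a conjugate of a subgroup
of `P₂`. -/
def PreservesPeripheral {G₁ G₂ : Type*} [Group G₁] [Group G₂] (P₁ : Subgroup G₁)
    (P₂ : Subgroup G₂) (φ : G₁ →* G₂) : Prop :=
  ∃ c : G₂, ∀ p ∈ P₁, c * φ p * c⁻¹ ∈ P₂

/-- `k₁ ⪰ k₂`: there is an epimorphism of knot groups that preserves peripheral structure. This is
required for all choices of the tubular neighbourhoods and base points that enter the
knot groups. -/
def Dominates (k₁ k₂ : Knot) : Prop :=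
  ∀ V₁ V₂ : Set S3, IsTubularNhd V₁ k₁.carrier → IsTubularNhd V₂ k₂.carrier →
    ∀ (x₁ : ↥(frontier V₁)) (x₂ : ↥(frontier V₂)),
      ∃ φ : KnotGroup V₁ x₁ →* KnotGroup V₂ x₂, Function.Surjective φ ∧
        PreservesPeripheral (peripheralSubgroup V₁ x₁) (peripheralSubgroup V₂ x₂) φ

infix:50 " ⪰ " => Dominates

/-! ### Longitudes -/

/-- The loop `t ↦ exp (2πit)` that runs once around the circle. -/
noncomputable def circleLoop : Path (1 : Circle) 1 where
  toFun t := Circle.exp (2 * Real.pi * (t : ℝ))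
  continuous_toFun := by fun_prop
  source' := by simp
  target' := by simp

/-- A closed curve `c` in `X` is null-homologous if its class in `H₁`, that is, in the
abelianization of the fundamental group at a point of the curve, is trivial. -/
def NullHomologous {X : Type*} [TopologicalSpace X] (c : C(Circle, X)) : Prop :=
  Abelianization.of
    (FundamentalGroup.map c 1 (FundamentalGroup.fromPath (Path.Homotopic.Quotient.mk circleLoop)))
    = 1

/-- `c` is a longitude of the solid torus `V` in the 3-sphere: an essential simple closed curve
in `∂V` that is null-homologous in `S³ \ int V`. -/
def IsLongitude (V : Set S3) (c : C(Circle, ↥(frontier V))) : Prop :=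
  Function.Injective c ∧ ¬ c.Nullhomotopic ∧ NullHomologous ((boundaryInclusion V).comp c)

/-! ### Satellites -/

/-- The solid torus `{(z, w) : |w| ≤ |z|}` in the unit sphere of `ℂ² = ℝ⁴`. -/
def cliffordSolidTorus : Set S3 :=
  {x | x.1 2 ^ 2 + x.1 3 ^ 2 ≤ x.1 0 ^ 2 + x.1 1 ^ 2}

/-- `V` is a standard (that is, smoothly unknotted) solid torus in the 3-sphere. -/
def IsStandardSolidTorus (V : Set S3) : Prop :=
  ∃ h : S3 ≃ₘ⟮𝓡 3, 𝓡 3⟯ S3, h '' cliffordSolidTorus = V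

/-- A presentation of the knot `k` as a satellite with pattern knot `kt`. -/
structure SatelliteData (k kt : Knot) where
  /-- the standard solid torus that contains the pattern knot -/
  Vt : Set S3
  isStandardSolidTorus : IsStandardSolidTorus Vt
  pattern_subset : kt.carrier ⊆ interior Vt
  pattern_not_subset_ball : ∀ B : Set S3, IsThreeBall B → B ⊆ Vt → ¬ kt.carrier ⊆ B
  /-- the companion knot -/
  companion : Knot
  /-- a tubular neighbourhood of the companion knot -/
  Vh : Set S3
  isTubularNhd : IsTubularNhd Vh companion.carrier
  /-- the diffeomorphism from `Vt` to `Vh`; its values off `Vt` play no role -/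
  g : S3 → S3
  isLocalDiffeomorphOn : IsLocalDiffeomorphOn (𝓡 3) (𝓡 3) ∞ g Vt
  injOn : InjOn g Vt
  image_eq : g '' Vt = Vh
  /-- `g` sends a longitude `lt` of `Vt` to a longitude `lh` of `Vh` -/
  longitude : ∃ (lt : C(Circle, ↥(frontier Vt))) (lh : C(Circle, ↥(frontier Vh))),
    IsLongitude Vt lt ∧ IsLongitude Vh lh ∧ ∀ t, g (lt t) = lh t
  satellite_eq : g '' kt.carrier = k.carrier

/-- `k` is a satellite knot with pattern knot `kt`. -/
def IsSatelliteWithPattern (k kt : Knot) : Prop := Nonempty (SatelliteData k kt)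

/-! The inverse of `g`, defined on `Vh`, extends to a map `F` of the 3-sphere that sends the
complement of `Vh` outside the interior of `Vt` (`SatelliteData.exists_collapse`). Then `F` sends
exactly the points of `k` into `kt`, so it restricts to a map of knot complements, and this map
induces the epimorphism.

Extension: the complement of the interior of the standard torus `Vt` is again a solid torus, disc
times circle, so a map into it has two coordinates. The disc coordinate extends from the boundary of
`Vh` by Tietze. The circle coordinate `f` meets a cohomological obstruction, handled in
`exists_extension_to_exterior`. The exterior of `Vh` carries a circle-valued `α` of degree one on
the meridian. Both `f` and `α` lift to real functions along the longitude: `α` because the longitude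
bounds homologically outside `Vh`, and `f` because `g` matches it with a longitude of `Vt`. On a
torus this forces `f` to be a power of `α` times the exponential of a real function
(`exists_zpow_mul_mem_liftable`), and the real function extends by Tietze. The existence of `α`
amounts to the triviality of circle bundles over the 3-sphere (`splitsOn_S3`), proved by
subdivision.

Surjectivity: a loop in the complement of `kt` can be pushed off the core of the complementary solid
torus and then into `Vt` (`IsSolidTorusCoords.surjective_map_inclusion`). Loops in `Vt` off `kt` are
images under `F`, because `F` inverts `g`.

Peripheral structure: a thin torus around `k` is sent by `F` into the chosen tube about `kt`, off
its core, and radial retraction carries it to the boundary of that tube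
(`exists_epimorphism_preservesPeripheral`). -/

/-! ### Real lifts of circle-valued maps on sets -/

section Lifting

variable {X Y : Type*} [TopologicalSpace X] [TopologicalSpace Y]

/-- Two real lifts of a circle-valued map on a preconnected set differ by a period. -/
theorem exists_int_of_circleExp_eqOn {s : Set X} (hs : IsPreconnected s) {h₁ h₂ : X → ℝ}
    (c₁ : ContinuousOn h₁ s) (c₂ : ContinuousOn h₂ s)
    (h : ∀ x ∈ s, Circle.exp (h₁ x) = Circle.exp (h₂ x)) :
    ∃ n : ℤ, ∀ x ∈ s, h₁ x = h₂ x + n * (2 * Real.pi) := by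
  have hd : IsDiscrete (range ((↑) : ℤ → ℝ)) :=
    ⟨Int.isClosedEmbedding_coe_real.isEmbedding.toHomeomorph.symm.isEmbedding.discreteTopology⟩
  have hpi : (2 * Real.pi) ≠ 0 := by positivity
  have hc : ContinuousOn (fun x => (h₁ x - h₂ x) / (2 * Real.pi)) s := by fun_prop
  obtain ⟨y, ⟨n, rfl⟩, hy⟩ := hs.eqOn_const_of_mapsTo hd hc (fun x hx => by
    obtain ⟨m, hm⟩ := Circle.exp_eq_exp.1 (h x hx)
    refine ⟨m, ?_⟩
    simp only [hm]
    field_simp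
    ring) (range_nonempty _)
  refine ⟨n, fun x hx => ?_⟩
  have := hy hx
  simp only [Function.const_apply] at this
  field_simp at this
  linarith

/-- The circle-valued map `u` has a continuous real lift on `s`. -/
def LiftsOn (u : X → Circle) (s : Set X) : Prop :=
  ∃ h : X → ℝ, ContinuousOn h s ∧ ∀ x ∈ s, Circle.exp (h x) = u x

/-- Every continuous circle-valued map on `s` has a continuous real lift. -/
def IsLiftingSet (s : Set X) : Prop :=
  ∀ u : X → Circle, ContinuousOn u s → LiftsOn u s

/-- A set that contracts in itself to a point is a lifting set. -/
theorem isLiftingSet_of_contraction {s : Set X} (H : ℝ → X → X) (x₀ : X)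
    (hc : ContinuousOn (fun p : ℝ × X => H p.1 p.2) (Icc 0 1 ×ˢ s))
    (hm : ∀ t ∈ Icc (0 : ℝ) 1, ∀ x ∈ s, H t x ∈ s)
    (h0 : ∀ x ∈ s, H 0 x = x₀) (h1 : ∀ x ∈ s, H 1 x = x) : IsLiftingSet s := by
  classical
  intro u hu
  obtain ⟨e, he⟩ := Circle.exp_surjective (u x₀)
  let G : C(unitInterval × s, Circle) := ⟨fun p => u (H p.1 p.2), by
    refine hu.comp_continuous (f := fun p : unitInterval × s => H p.1 p.2) ?_ ?_
    · exact hc.comp_continuous (f := fun p : unitInterval × s => ((p.1 : ℝ), (p.2 : X)))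
        (by fun_prop) (fun p => ⟨p.1.2, p.2.2⟩)
    · exact fun p => hm _ p.1.2 _ p.2.2⟩
  have hG : ∀ a : s, G (0, a) = Circle.exp ((ContinuousMap.const s e) a) := fun a => by
    simp [G, h0 a a.2, he]
  let L := Circle.isCoveringMap_exp.liftHomotopy G (ContinuousMap.const s e) hG
  have hL : ∀ p, Circle.exp (L p) = G p := fun p =>
    congrFun (Circle.isCoveringMap_exp.liftHomotopy_lifts G _ hG) p
  refine ⟨fun x => if hx : x ∈ s then L (1, ⟨x, hx⟩) else 0, ?_, fun x hx => ?_⟩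
  · rw [continuousOn_iff_continuous_domRestrict]
    convert! (show Continuous (fun x : s => L (1, x)) by fun_prop) using 1
    ext x
    simp
  · simp [hx, hL, G, h1 x hx]

theorem Convex.isLiftingSet {E : Type*} [NormedAddCommGroup E] [NormedSpace ℝ E] {s : Set E}
    (hs : Convex ℝ s) : IsLiftingSet s := by
  rcases s.eq_empty_or_nonempty with rfl | ⟨x₀, hx₀⟩
  · exact fun u _ => ⟨fun _ => 0, by simp, by simp⟩
  · refine isLiftingSet_of_contraction (fun t x => x₀ + t • (x - x₀)) x₀ (by fun_prop) ?_ ?_ ?_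
    · intro t ht x hx
      exact hs.add_smul_sub_mem hx₀ hx ht
    · simp
    · simp

/-- The pasting lemma relative to an arbitrary `U`: a point outside the closed set `s` is not in the
closure of `s ∩ U`, so that piece imposes no condition there. -/
theorem continuousOn_union_inter {Z : Type*} [TopologicalSpace Z] {s t U : Set X} {f : X → Z}
    (hs : IsClosed s) (ht : IsClosed t) (h₁ : ContinuousOn f (s ∩ U))
    (h₂ : ContinuousOn f (t ∩ U)) : ContinuousOn f ((s ∪ t) ∩ U) := by
  rintro x ⟨_, hxU⟩
  rw [union_inter_distrib_right, continuousWithinAt_union]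
  have key : ∀ r : Set X, IsClosed r → ContinuousOn f (r ∩ U) → ContinuousWithinAt f (r ∩ U) x := by
    intro r hr h
    by_cases hx : x ∈ r
    · exact h x ⟨hx, hxU⟩
    · refine continuousWithinAt_of_notMem_closure fun hx' => hx ?_
      exact hr.closure_subset_iff.2 inter_subset_left hx'
  exact ⟨key s hs h₁, key t ht h₂⟩

/-- On the connected overlap the two lifts differ by one constant period; shifting the second lift
by it makes them agree. -/
theorem IsLiftingSet.union {s t : Set X} (hs : IsLiftingSet s) (ht : IsLiftingSet t)
    (cs : IsClosed s) (ct : IsClosed t) (hst : IsPreconnected (s ∩ t)) :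
    IsLiftingSet (s ∪ t) := by
  classical
  intro u hu
  obtain ⟨h₁, c₁, e₁⟩ := hs u (hu.mono subset_union_left)
  obtain ⟨h₂, c₂, e₂⟩ := ht u (hu.mono subset_union_right)
  obtain ⟨n, hn⟩ := exists_int_of_circleExp_eqOn hst (c₁.mono inter_subset_left)
    (c₂.mono inter_subset_right) (fun x hx => (e₁ x hx.1).trans (e₂ x hx.2).symm)
  refine ⟨fun x => if x ∈ s then h₁ x else h₂ x + n * (2 * Real.pi), ?_, ?_⟩
  · have := continuousOn_union_inter (U := univ) (Z := ℝ) (s := s) (t := t)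
      (f := fun x => if x ∈ s then h₁ x else h₂ x + n * (2 * Real.pi)) cs ct ?_ ?_
    · simpa using this
    · refine c₁.congr_mono (fun x hx => ?_) inter_subset_left
      simp [hx.1]
    · refine (c₂.add continuousOn_const).congr_mono (f := fun x => h₂ x + n * (2 * Real.pi))
        (fun x hx => ?_) inter_subset_left
      by_cases hxs : x ∈ s
      · simp [hxs, hn x ⟨hxs, hx.1⟩]
      · simp [hxs]
  · intro x hx
    by_cases hxs : x ∈ s
    · simp [hxs, e₁ x hxs]
    · have hxt : x ∈ t := hx.resolve_left hxs
      simp only [hxs, if_false]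
      rw [← e₂ x hxt, Circle.exp_eq_exp]
      exact ⟨n, rfl⟩

theorem IsLiftingSet.image {s : Set X} (hs : IsLiftingSet s) {f : X → Y}
    (hf : Topology.IsEmbedding f) : IsLiftingSet (f '' s) := by
  intro u hu
  obtain ⟨h, hc, he⟩ := hs (u ∘ f) (hu.comp hf.continuous.continuousOn (mapsTo_image f s))
  have hinv : ∀ x, Function.extend f h 0 (f x) = h x := fun x => hf.injective.extend_apply h 0 x
  refine ⟨Function.extend f h 0, ?_, ?_⟩
  · rintro _ ⟨x, hx, rfl⟩
    have := (hc x hx)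
    rw [ContinuousWithinAt, hinv, ← hf.map_nhdsWithin_eq, Filter.tendsto_map'_iff]
    exact this.congr' (Filter.Eventually.of_forall fun y => (hinv y).symm)
  · rintro _ ⟨x, hx, rfl⟩
    rw [hinv]
    exact he x hx

end Lifting

/-! ### Liftable maps and degrees on the circle and the torus -/

section Liftable

variable {X Y : Type*} [TopologicalSpace X] [TopologicalSpace Y]

/-- The subgroup of circle-valued maps that lift to real-valued maps. -/
def liftable (X : Type*) [TopologicalSpace X] : Subgroup C(X, Circle) where
  carrier := {u | ∃ h : C(X, ℝ), ∀ x, Circle.exp (h x) = u x}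
  one_mem' := ⟨0, fun x => by simp⟩
  mul_mem' := by
    rintro u v ⟨h, hh⟩ ⟨k, hk⟩
    exact ⟨h + k, fun x => by simp [Circle.exp_add, hh, hk]⟩
  inv_mem' := by
    rintro u ⟨h, hh⟩
    exact ⟨-h, fun x => by simp [Circle.exp_neg, hh]⟩

theorem comp_mem_liftable {u : C(X, Circle)} (hu : u ∈ liftable X) (f : C(Y, X)) :
    u.comp f ∈ liftable Y := by
  obtain ⟨h, hh⟩ := hu
  exact ⟨h.comp f, fun x => hh (f x)⟩

theorem mem_liftable_of_isQuotientMap {q : C(Y, X)} (hq : Topology.IsQuotientMap q)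
    {u : C(X, Circle)} (H : C(Y, ℝ)) (hH : ∀ y, Circle.exp (H y) = u (q y))
    (hc : ∀ y y', q y = q y' → H y = H y') : u ∈ liftable X := by
  refine ⟨hq.lift H fun y y' h => hc y y' h, fun x => ?_⟩
  obtain ⟨y, rfl⟩ := hq.surjective x
  rw [← hH]
  congr 1
  exact congrArg (fun f : C(Y, ℝ) => f y) (hq.lift_comp H fun y y' h => hc y y' h)

theorem mem_liftable_of_convex {E : Type*} [NormedAddCommGroup E] [NormedSpace ℝ E]
    (u : C(E, Circle)) : u ∈ liftable E := by
  obtain ⟨h, hc, he⟩ := (convex_univ (𝕜 := ℝ) (E := E)).isLiftingSet u u.continuous.continuousOn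
  exact ⟨⟨h, continuousOn_univ.1 hc⟩, fun x => he x (mem_univ x)⟩

/-- The exponential as a continuous map onto the circle. -/
noncomputable def expMap : C(ℝ, Circle) := ⟨Circle.exp, by fun_prop⟩

theorem isOpenQuotientMap_expMap : IsOpenQuotientMap expMap :=
  ⟨Circle.exp_surjective, expMap.continuous, isLocalHomeomorph_circleExp.isOpenMap⟩

theorem eq_add_of_circleExp_eq {E : Type*} [NormedAddCommGroup E] [NormedSpace ℝ E]
    (H K : C(E, ℝ)) (h : ∀ x, Circle.exp (H x) = Circle.exp (K x)) :
    ∃ n : ℤ, ∀ x, H x = K x + n * (2 * Real.pi) := by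
  obtain ⟨n, hn⟩ := exists_int_of_circleExp_eqOn (isPreconnected_univ (α := E))
    H.continuous.continuousOn K.continuous.continuousOn (fun x _ => h x)
  exact ⟨n, fun x => hn x (mem_univ x)⟩

theorem apply_add_int_mul_two_pi {a : ℝ} {h : ℝ → ℝ}
    (ha : ∀ t, h (t + 2 * Real.pi) = h t + a) (t : ℝ) (m : ℤ) :
    h (t + m * (2 * Real.pi)) = h t + m * a := by
  induction m using Int.induction_on with
  | zero => simp
  | succ i hi =>
    have := ha (t + i * (2 * Real.pi))
    push_cast at hi ⊢
    rw [show t + ((i : ℝ) + 1) * (2 * Real.pi) = t + i * (2 * Real.pi) + 2 * Real.pi by ring,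
      this, hi]
    ring
  | pred i hi =>
    have := ha (t + (-i - 1 : ℝ) * (2 * Real.pi))
    push_cast at hi ⊢
    rw [show t + (-i - 1 : ℝ) * (2 * Real.pi) + 2 * Real.pi = t + -i * (2 * Real.pi) by ring,
      hi] at this
    linarith

/-- Every self-map of the circle is a power of the identity up to liftable maps. -/
theorem exists_zpow_mem_liftable (u : C(Circle, Circle)) :
    ∃ n : ℤ, u * (ContinuousMap.id Circle ^ n)⁻¹ ∈ liftable Circle := by
  -- The increment of the lift `H` over one period is `2πn`, with `n` the degree; subtracting `n •
  -- id` leaves a periodic function, which descends to the circle.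
  obtain ⟨H, hH⟩ := mem_liftable_of_convex (u.comp expMap)
  obtain ⟨n, hn⟩ := eq_add_of_circleExp_eq (H.comp ⟨fun t => t + 2 * Real.pi, by fun_prop⟩) H
    (fun t => by simp [hH, expMap, Circle.exp_add])
  refine ⟨n, mem_liftable_of_isQuotientMap isOpenQuotientMap_expMap.isQuotientMap
    (H - n • ContinuousMap.id ℝ) (fun t => ?_) fun t t' h => ?_⟩
  · simp [Circle.exp_sub, hH, expMap, div_eq_mul_inv]
  · obtain ⟨m, rfl⟩ := Circle.exp_eq_exp.1 h
    have := apply_add_int_mul_two_pi (h := H) (a := n * (2 * Real.pi)) hn t' m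
    simp [this]
    ring

/-- Pulled back to the line, a lift of the `n`-th power is `n • id` plus a constant, and it must
also be periodic. -/
theorem eq_zero_of_zpow_mem_liftable {n : ℤ}
    (h : ContinuousMap.id Circle ^ n ∈ liftable Circle) : n = 0 := by
  obtain ⟨h, hh⟩ := h
  obtain ⟨m, hm⟩ := eq_add_of_circleExp_eq (h.comp expMap) (n • ContinuousMap.id ℝ) (fun t => by
    simp [hh, expMap])
  have h0 := hm 0
  have h1 := hm (2 * Real.pi)
  simp [expMap] at h0 h1
  have hpi := Real.pi_pos
  rw [h0] at h1
  have : (n : ℝ) * (2 * Real.pi) = 0 := by linarith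
  have := (mul_eq_zero.1 this).resolve_right (by positivity)
  exact_mod_cast this

/-- The first coordinate axis of the torus. -/
noncomputable def torusFst : C(Circle, Circle × Circle) := ⟨fun z => (z, 1), by fun_prop⟩

/-- The second coordinate axis of the torus. -/
noncomputable def torusSnd : C(Circle, Circle × Circle) := ⟨fun z => (1, z), by fun_prop⟩

/-- A lift over the plane changes by a constant under each period translation. That constant can be
read off on the axes, where the hypotheses make it zero; so the lift descends to the torus. -/
theorem mem_liftable_torus {u : C(Circle × Circle, Circle)}
    (h₁ : u.comp torusFst ∈ liftable Circle) (h₂ : u.comp torusSnd ∈ liftable Circle) :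
    u ∈ liftable (Circle × Circle) := by
  obtain ⟨k₁, hk₁⟩ := h₁
  obtain ⟨k₂, hk₂⟩ := h₂
  have hq := isOpenQuotientMap_expMap.prodMap isOpenQuotientMap_expMap
  let q : C(ℝ × ℝ, Circle × Circle) := expMap.prodMap expMap
  obtain ⟨H, hH⟩ := mem_liftable_of_convex (u.comp q)
  have hper1 : ∀ t s, H (s + 2 * Real.pi, t) = H (s, t) + 0 := by
    obtain ⟨n, hn⟩ := eq_add_of_circleExp_eq
      (H.comp ⟨fun p => (p.1 + 2 * Real.pi, p.2), by fun_prop⟩) H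
      (fun t => by simp [hH, q, expMap, Circle.exp_add, Prod.map])
    obtain ⟨m, hm⟩ := eq_add_of_circleExp_eq
      (H.comp ⟨fun t : ℝ => (t, (0 : ℝ)), by fun_prop⟩) (k₁.comp expMap)
      (fun t => by simp [hH, hk₁, q, expMap, torusFst])
    have e0 := hm 0
    have e1 := hm (2 * Real.pi)
    have e2 := hn (0, 0)
    simp [expMap] at e0 e1 e2
    intro t s
    have := hn (s, t)
    simp at this
    rw [this]
    linarith
  have hper2 : ∀ s t, H (s, t + 2 * Real.pi) = H (s, t) + 0 := by
    obtain ⟨n, hn⟩ := eq_add_of_circleExp_eq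
      (H.comp ⟨fun p => (p.1, p.2 + 2 * Real.pi), by fun_prop⟩) H
      (fun t => by simp [hH, q, expMap, Circle.exp_add, Prod.map])
    obtain ⟨m, hm⟩ := eq_add_of_circleExp_eq
      (H.comp ⟨fun t : ℝ => ((0 : ℝ), t), by fun_prop⟩) (k₂.comp expMap)
      (fun t => by simp [hH, hk₂, q, expMap, torusSnd])
    have e0 := hm 0
    have e1 := hm (2 * Real.pi)
    have e2 := hn (0, 0)
    simp [expMap] at e0 e1 e2
    intro s t
    have := hn (s, t)
    simp at this
    rw [this]
    linarith
  refine mem_liftable_of_isQuotientMap (q := q) hq.isQuotientMap H (fun y => hH y) ?_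
  rintro ⟨s, t⟩ ⟨s', t'⟩ h
  obtain ⟨m, rfl⟩ := Circle.exp_eq_exp.1 (congrArg Prod.fst h)
  obtain ⟨n, rfl⟩ := Circle.exp_eq_exp.1 (congrArg Prod.snd h)
  have e1 := apply_add_int_mul_two_pi (h := fun s => H (s, t' + n * (2 * Real.pi))) (a := 0)
    (hper1 _) s' m
  have e2 := apply_add_int_mul_two_pi (h := fun t => H (s', t)) (a := 0) (hper2 _) t' n
  simp only [mul_zero, add_zero] at e1 e2
  rw [e1, e2]

/-- A map to a torus whose coordinates lift is nullhomotopic. -/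
theorem nullhomotopic_of_mem_liftable {ℓ : C(X, Circle × Circle)}
    (h₁ : (ContinuousMap.fst.comp ℓ) ∈ liftable X) (h₂ : (ContinuousMap.snd.comp ℓ) ∈ liftable X) :
    ℓ.Nullhomotopic := by
  obtain ⟨k₁, hk₁⟩ := h₁
  obtain ⟨k₂, hk₂⟩ := h₂
  have : ℓ = (expMap.prodMap expMap).comp (k₁.prodMk k₂) := by
    ext x
    · exact congrArg _ (hk₁ x).symm
    · exact congrArg _ (hk₂ x).symm
  rw [this]
  have h0 : (k₁.prodMk k₂).Nullhomotopic := by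
    have := (id_nullhomotopic (ℝ × ℝ)).comp_left (k₁.prodMk k₂)
    simpa using this
  exact h0.comp_right _

/-- If `α` and `f` kill an essential curve `ℓ` on the torus and `α` has degree one on the second
axis, then `f` is a power of `α` up to liftable maps. -/
theorem exists_zpow_mul_mem_liftable {α f : C(Circle × Circle, Circle)}
    {ℓ : C(Circle, Circle × Circle)} (hℓ : ¬ ℓ.Nullhomotopic)
    (hα : α.comp ℓ ∈ liftable Circle) (hf : f.comp ℓ ∈ liftable Circle)
    (hα₁ : α.comp torusSnd * (ContinuousMap.id Circle)⁻¹ ∈ liftable Circle) :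
    ∃ n : ℤ, f * (α ^ n)⁻¹ ∈ liftable (Circle × Circle) := by
  -- up to liftable maps, `u` is the monomial with exponents its degrees on the axes
  have key : ∀ u : C(Circle × Circle, Circle), ∀ a b : ℤ,
      u.comp torusFst * (ContinuousMap.id Circle ^ a)⁻¹ ∈ liftable Circle →
      u.comp torusSnd * (ContinuousMap.id Circle ^ b)⁻¹ ∈ liftable Circle →
      u * (ContinuousMap.fst ^ a * ContinuousMap.snd ^ b)⁻¹ ∈ liftable (Circle × Circle) := by
    intro u a b ha hb
    refine mem_liftable_torus ?_ ?_
    · convert! ha using 1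
      ext z
      simp [torusFst]
    · convert! hb using 1
      ext z
      simp [torusSnd]
  obtain ⟨a, ha⟩ := exists_zpow_mem_liftable (α.comp torusFst)
  obtain ⟨c, hc⟩ := exists_zpow_mem_liftable (f.comp torusFst)
  obtain ⟨d, hd⟩ := exists_zpow_mem_liftable (f.comp torusSnd)
  obtain ⟨p, hp⟩ := exists_zpow_mem_liftable (ContinuousMap.fst.comp ℓ)
  obtain ⟨q, hq⟩ := exists_zpow_mem_liftable (ContinuousMap.snd.comp ℓ)
  have kα := key α a 1 ha (by simpa using hα₁)
  have kf := key f c d hc hd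
  have deg : ∀ (u : C(Circle × Circle, Circle)) (a b : ℤ),
      u * (ContinuousMap.fst ^ a * ContinuousMap.snd ^ b)⁻¹ ∈ liftable (Circle × Circle) →
      u.comp ℓ ∈ liftable Circle → a * p + b * q = 0 := by
    intro u a b h1 h2
    apply eq_zero_of_zpow_mem_liftable
    have h3 := comp_mem_liftable h1 ℓ
    have h4 := mul_mem (mul_mem (inv_mem h3) h2)
      (inv_mem (mul_mem (zpow_mem hp a) (zpow_mem hq b)))
    convert! h4 using 1
    ext z
    simp [zpow_add, zpow_mul', mul_zpow]
    field_simp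
  -- With bidegrees `(a, 1)` for `α`, `(c, d)` for `f` and winding `(p, q)` for `ℓ`, these say `ap +
  -- q = 0` and `cp + dq = 0`. If `p = 0` then `q = 0` and `ℓ` would be inessential; hence `c = da`,
  -- so `f` has the bidegree of `α ^ d`.
  have e1 := deg α a 1 kα hα
  have e2 := deg f c d kf hf
  have hp0 : p ≠ 0 := by
    rintro rfl
    have hq0 : q = 0 := by simpa using e1
    subst hq0
    exact hℓ (nullhomotopic_of_mem_liftable (by simpa using hp) (by simpa using hq))
  have hcd : c = d * a := by
    have : (c - d * a) * p = 0 := by linear_combination e2 - d * e1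
    have := (mul_eq_zero.1 this).resolve_right hp0
    linarith
  refine ⟨d, ?_⟩
  have h4 := mul_mem kf (inv_mem (zpow_mem kα d))
  convert! h4 using 1
  subst hcd
  ext z
  simp [zpow_mul', mul_zpow]
  field_simp
  exact (div_self (zpow_ne_zero _ (zpow_ne_zero _ (Circle.coe_ne_zero _)))).symm

/-- Circle-valued maps lift along null-homologous curves. -/
theorem NullHomologous.comp_mem_liftable {c : C(Circle, X)} (hc : NullHomologous c)
    (α : C(X, Circle)) : α.comp c ∈ liftable Circle := by
  obtain ⟨n, h, hh⟩ := exists_zpow_mem_liftable (α.comp c)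
  set β := FundamentalGroup.map c 1
    (FundamentalGroup.fromPath (Path.Homotopic.Quotient.mk circleLoop)) with hβ
  have he : Circle.exp (h 1) = α (c 1) := by simp [hh]
  let E := Circle.isAddQuotientCoveringMap_exp.fundamentalGroupEquiv (x := α (c 1)) ⟨h 1, he⟩
  -- The fundamental group of the circle is abelian, so the induced map factors through the
  -- abelianization, where the class of the curve vanishes.
  have h1 : E (FundamentalGroup.map α (c 1) β) = 1 := by
    let ψ := Abelianization.lift (E.toMonoidHom.comp (FundamentalGroup.map α (c 1)))
    have : ψ (Abelianization.of β) = 1 := by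
      have : Abelianization.of β = 1 := hc
      rw [this, map_one]
    simpa [ψ] using this
  have h2 : FundamentalGroup.map α (c 1) β = 1 := by simpa using h1
  have h3 : ((circleLoop.map c.continuous).map α.continuous).Homotopic (Path.refl _) :=
    Quotient.exact h2
  have h5 := Circle.isCoveringMap_exp.liftPath_apply_one_eq_of_homotopicRel h3 (h 1)
    (by simp [he]) (by simp [he])
  -- The lift of the loop `α ∘ c` starting at `h 1`; it ends at `h 1 + 2πn`. As the loop is
  -- nullhomotopic, its lift closes up, so `n = 0`.
  let Γ : C(unitInterval, ℝ) :=
    ⟨fun t => h (circleLoop t) + n * (2 * Real.pi * (t : ℝ)), by fun_prop⟩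
  have h6 : Γ = Circle.isCoveringMap_exp.liftPath
      ((circleLoop.map c.continuous).map α.continuous).toContinuousMap (h 1) (by simp [he]) :=
    (Circle.isCoveringMap_exp.eq_liftPath_iff' _).2 ⟨by
      ext t
      simp [Γ, Circle.exp_add, hh, circleLoop], by simp [Γ]⟩
  have h7 : ContinuousMap.const _ (h 1) = Circle.isCoveringMap_exp.liftPath
      (Path.refl (α (c 1))).toContinuousMap (h 1) (by simp [he]) :=
    (Circle.isCoveringMap_exp.eq_liftPath_iff' _).2 ⟨by
      ext t
      simp [he], by simp⟩
  have h8 : Γ 1 = h 1 := by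
    rw [h6]
    refine h5.trans ?_
    rw [← h7]
    rfl
  have hn : (n : ℝ) = 0 := by
    have hpi := Real.pi_pos
    have : (n : ℝ) * (2 * Real.pi) = 0 := by simpa [Γ] using h8
    exact (mul_eq_zero.1 this).resolve_right (by positivity)
  have hn : n = 0 := by exact_mod_cast hn
  subst hn
  exact ⟨h, by simpa using hh⟩

end Liftable

/-! ### Splitting circle-valued transition functions -/

section Splitting

variable {X Y : Type*} [TopologicalSpace X] [TopologicalSpace Y]

/-- Over `S`, the transition function `u` on `U₁ ∩ U₂` is a product of functions on `U₁`
and on `U₂`. -/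
def SplitsOn (u : X → Circle) (U₁ U₂ S : Set X) : Prop :=
  ∃ a b : X → Circle, ContinuousOn a (S ∩ U₁) ∧ ContinuousOn b (S ∩ U₂) ∧
    ∀ x ∈ S, x ∈ U₁ → x ∈ U₂ → a x * b x = u x

theorem SplitsOn.mono {u : X → Circle} {U₁ U₂ S T : Set X} (h : SplitsOn u U₁ U₂ S)
    (hT : T ⊆ S) : SplitsOn u U₁ U₂ T := by
  obtain ⟨a, b, ha, hb, hab⟩ := h
  exact ⟨a, b, ha.mono (inter_subset_inter_left _ hT), hb.mono (inter_subset_inter_left _ hT),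
    fun x hx => hab x (hT hx)⟩

theorem SplitsOn.of_subset {u : X → Circle} {U₁ U₂ S : Set X} (hu : ContinuousOn u (U₁ ∩ U₂))
    (hS : S ⊆ U₁ ∨ S ⊆ U₂) : SplitsOn u U₁ U₂ S := by
  rcases hS with hS | hS
  · exact ⟨1, u, continuousOn_const, hu.mono (inter_subset_inter_left _ hS), by simp⟩
  · exact ⟨u, 1, hu.mono fun x hx => ⟨hx.2, hS hx.1⟩, continuousOn_const, by simp⟩

theorem SplitsOn.image {f : X → Y} (hf : Topology.IsEmbedding f) {u : Y → Circle}
    {U₁ U₂ : Set Y} {S : Set X} (h : SplitsOn (u ∘ f) (f ⁻¹' U₁) (f ⁻¹' U₂) S) :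
    SplitsOn u U₁ U₂ (f '' S) := by
  obtain ⟨a, b, ha, hb, hab⟩ := h
  have hext : ∀ (a : X → Circle) x, Function.extend f a 1 (f x) = a x :=
    fun a x => hf.injective.extend_apply a 1 x
  have key : ∀ (a : X → Circle) (U : Set Y), ContinuousOn a (S ∩ f ⁻¹' U) →
      ContinuousOn (Function.extend f a 1) (f '' S ∩ U) := by
    intro a U ha
    rw [← image_inter_preimage]
    rintro _ ⟨x, hx, rfl⟩
    have := ha x hx
    rw [ContinuousWithinAt, hext, ← hf.map_nhdsWithin_eq, Filter.tendsto_map'_iff]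
    exact this.congr' (Filter.Eventually.of_forall fun y => (hext a y).symm)
  refine ⟨_, _, key a U₁ ha, key b U₂ hb, ?_⟩
  rintro _ ⟨x, hx, rfl⟩ h1 h2
  rw [hext, hext]
  exact hab x hx h1 h2

/-- Splittings over closed sets can be glued if their intersection is a lifting set. -/
theorem SplitsOn.union [NormalSpace X] {u : X → Circle} {U₁ U₂ S T : Set X}
    (hU : U₁ ∪ U₂ = univ) (o₁ : IsOpen U₁) (o₂ : IsOpen U₂)
    (hS : SplitsOn u U₁ U₂ S) (hT : SplitsOn u U₁ U₂ T) (cS : IsClosed S) (cT : IsClosed T)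
    (hST : IsLiftingSet (S ∩ T)) : SplitsOn u U₁ U₂ (S ∪ T) := by
  classical
  obtain ⟨a, b, ha, hb, hab⟩ := hS
  obtain ⟨a', b', ha', hb', hab'⟩ := hT
  -- the ratio of the two splittings over `S ∩ T`
  let c : X → Circle := fun x => if x ∈ U₁ then a x * (a' x)⁻¹ else b' x * (b x)⁻¹
  have c1 : ∀ x ∈ U₁, c x = a x * (a' x)⁻¹ := fun x hx => if_pos hx
  have c2 : ∀ x ∈ S ∩ T, x ∈ U₂ → c x = b' x * (b x)⁻¹ := by
    intro x hx h2
    by_cases h1 : x ∈ U₁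
    · rw [c1 x h1, ← div_eq_mul_inv, ← div_eq_mul_inv, div_eq_div_iff_mul_eq_mul,
        hab x hx.1 h1 h2, mul_comm, hab' x hx.2 h1 h2]
    · exact if_neg h1
  have hc : ContinuousOn c (S ∩ T) := by
    intro x hx
    have hxU : x ∈ U₁ ∪ U₂ := hU ▸ mem_univ x
    rcases hxU with h | h
    · rw [← continuousWithinAt_inter (o₁.mem_nhds h)]
      have h1 : ContinuousOn (fun x => a x * (a' x)⁻¹) (S ∩ T ∩ U₁) :=
        (ha.mono fun y hy => ⟨hy.1.1, hy.2⟩).mul (ha'.mono fun y hy => ⟨hy.1.2, hy.2⟩).inv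
      exact (h1.congr fun y hy => c1 y hy.2) x ⟨hx, h⟩
    · rw [← continuousWithinAt_inter (o₂.mem_nhds h)]
      have h1 : ContinuousOn (fun x => b' x * (b x)⁻¹) (S ∩ T ∩ U₂) :=
        (hb'.mono fun y hy => ⟨hy.1.2, hy.2⟩).mul (hb.mono fun y hy => ⟨hy.1.1, hy.2⟩).inv
      exact (h1.congr fun y hy => c2 y hy.1 hy.2) x ⟨hx, h⟩
  obtain ⟨h, hh, he⟩ := hST c hc
  -- The ratio is lifted because real functions, unlike circle-valued ones, extend by Tietze.
  -- Multiplying `a'` by `exp H` and `b'` by its inverse corrects the splitting over `T` without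
  -- changing the product.
  obtain ⟨H, hH⟩ := ContinuousMap.exists_restrict_eq (cS.inter cT)
    ⟨(S ∩ T).domRestrict h, continuousOn_iff_continuous_domRestrict.1 hh⟩
  have hH' : ∀ x ∈ S ∩ T, Circle.exp (H x) = c x := fun x hx => by
    rw [← he x hx]
    exact congrArg _ (congrArg (fun f : C(↥(S ∩ T), ℝ) => f ⟨x, hx⟩) hH)
  have hHc : Continuous fun x => Circle.exp (H x) := by fun_prop
  have glue : ∀ (a a' : X → Circle) (U : Set X), ContinuousOn a (S ∩ U) →
      ContinuousOn a' (T ∩ U) → (∀ x ∈ S ∩ T, x ∈ U → a x = a' x) →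
      ContinuousOn (fun x => if x ∈ S then a x else a' x) ((S ∪ T) ∩ U) := by
    intro a a' U ha ha' haa
    refine continuousOn_union_inter cS cT (ha.congr fun x hx => if_pos hx.1)
      (ha'.congr fun x hx => ?_)
    by_cases hxS : x ∈ S
    · simp [hxS, haa x ⟨hxS, hx.1⟩ hx.2]
    · simp [hxS]
  refine ⟨_, _, glue a (fun x => Circle.exp (H x) * a' x) U₁ ha (hHc.continuousOn.mul ha') ?_,
    glue b (fun x => (Circle.exp (H x))⁻¹ * b' x) U₂ hb (hHc.continuousOn.inv.mul hb') ?_, ?_⟩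
  · intro x hx h1
    simp [hH' x hx, c1 x h1]
  · intro x hx h2
    simp [hH' x hx, c2 x hx h2]
  · intro x hx h1 h2
    by_cases hxS : x ∈ S
    · simp [hxS, hab x hxS h1 h2]
    · have := hab' x (hx.resolve_left hxS) h1 h2
      simp only [hxS, if_false]
      rw [mul_mul_mul_comm]
      simp [this]

/-- Transition functions split over compact convex sets. -/
theorem SplitsOn.of_isCompact_convex {n : ℕ} {u : (Fin n → ℝ) → Circle} {U₁ U₂ : Set (Fin n → ℝ)}
    (hU : U₁ ∪ U₂ = univ) (o₁ : IsOpen U₁) (o₂ : IsOpen U₂) (hu : ContinuousOn u (U₁ ∩ U₂))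
    {K : Set (Fin n → ℝ)} (hK : IsCompact K) (hKc : Convex ℝ K) : SplitsOn u U₁ U₂ K := by
  classical
  -- Induction on size: a closed convex subset of `K` of width at most `2 * L i` in direction `i` is
  -- cut by a hyperplane into two of width at most `L i`. They meet in a convex set, hence a lifting
  -- set, and their splittings glue.
  let Good : (Fin n → ℝ) → Prop := fun L => ∀ C ⊆ K, IsClosed C → Convex ℝ C →
    (∀ j, ∃ m, ∀ x ∈ C, x j ∈ Icc m (m + L j)) → SplitsOn u U₁ U₂ C
  have double : ∀ L i, Good L → Good (Function.update L i (2 * L i)) := by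
    intro L i hL C hCK hC hCc hw
    obtain ⟨m, hm⟩ := hw i
    simp only [Function.update_self] at hm
    have c1 : IsClosed {x : Fin n → ℝ | x i ≤ m + L i} :=
      isClosed_le (continuous_apply i) continuous_const
    have c2 : IsClosed {x : Fin n → ℝ | m + L i ≤ x i} :=
      isClosed_le continuous_const (continuous_apply i)
    have v1 : Convex ℝ {x : Fin n → ℝ | x i ≤ m + L i} :=
      (convex_Iic (𝕜 := ℝ) (m + L i)).linear_preimage (LinearMap.proj (R := ℝ) (φ := fun _ : Fin n => ℝ) i)
    have v2 : Convex ℝ {x : Fin n → ℝ | m + L i ≤ x i} :=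
      (convex_Ici (𝕜 := ℝ) (m + L i)).linear_preimage (LinearMap.proj (R := ℝ) (φ := fun _ : Fin n => ℝ) i)
    have s1 : SplitsOn u U₁ U₂ (C ∩ {x | x i ≤ m + L i}) := by
      refine hL _ (inter_subset_left.trans hCK) (hC.inter c1) (hCc.inter v1) fun j => ?_
      by_cases hj : j = i
      · subst hj
        exact ⟨m, fun x hx => ⟨(hm x hx.1).1, hx.2⟩⟩
      · obtain ⟨m', hm'⟩ := hw j
        simp only [Function.update_of_ne hj] at hm'
        exact ⟨m', fun x hx => hm' x hx.1⟩
    have s2 : SplitsOn u U₁ U₂ (C ∩ {x | m + L i ≤ x i}) := by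
      refine hL _ (inter_subset_left.trans hCK) (hC.inter c2) (hCc.inter v2) fun j => ?_
      by_cases hj : j = i
      · subst hj
        exact ⟨m + L j, fun x hx => ⟨hx.2, by linarith [(hm x hx.1).2]⟩⟩
      · obtain ⟨m', hm'⟩ := hw j
        simp only [Function.update_of_ne hj] at hm'
        exact ⟨m', fun x hx => hm' x hx.1⟩
    have := s1.union hU o₁ o₂ s2 (hC.inter c1) (hC.inter c2)
      ((hCc.inter v1).inter (hCc.inter v2)).isLiftingSet
    refine this.mono fun x hx => ?_
    rcases le_total (x i) (m + L i) with h | h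
    · exact Or.inl ⟨hx, h⟩
    · exact Or.inr ⟨hx, h⟩
  have doubleAll : ∀ L, Good L → Good (fun j => 2 * L j) := by
    intro L hL
    have : ∀ s : Finset (Fin n), Good (fun j => if j ∈ s then 2 * L j else L j) := by
      intro s
      induction s using Finset.induction_on with
      | empty => simpa using hL
      | insert i s hi ih =>
        convert double _ i ih using 1
        ext j
        by_cases hj : j = i
        · subst hj
          simp [hi]
        · simp [hj]
    simpa using this Finset.univ
  -- In the sup metric, a set of coordinate widths at most `δ / 2` lies in a `δ`-ball about any of
  -- its points, hence in `U₁` or in `U₂`, where the splitting is trivial.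
  obtain ⟨δ, hδ, hleb⟩ := lebesgue_number_lemma_of_metric hK (c := fun i : Bool => cond i U₁ U₂)
    (by rintro (_ | _) <;> simpa) (by
      intro x _
      have : x ∈ U₁ ∪ U₂ := hU ▸ mem_univ x
      rw [mem_iUnion]
      rcases this with h | h
      · exact ⟨true, h⟩
      · exact ⟨false, h⟩)
  have base : Good (fun _ => δ / 2) := by
    intro C hCK _ _ hw
    apply SplitsOn.of_subset hu
    rcases C.eq_empty_or_nonempty with rfl | ⟨x, hx⟩
    · simp
    have hsub : C ⊆ ball x δ := by
      intro y hy
      rw [mem_ball, dist_pi_lt_iff hδ]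
      intro j
      obtain ⟨m, hm⟩ := hw j
      have h1 := hm x hx
      have h2 := hm y hy
      rw [Real.dist_eq, abs_lt]
      constructor <;> linarith [h1.1, h1.2, h2.1, h2.2]
    obtain ⟨i, hi⟩ := hleb x (hCK hx)
    cases i
    · exact Or.inr (hsub.trans hi)
    · exact Or.inl (hsub.trans hi)
  have iter : ∀ k : ℕ, Good (fun _ => 2 ^ k * (δ / 2)) := by
    intro k
    induction k with
    | zero => simpa using base
    | succ k ih =>
      have := doubleAll _ ih
      simpa only [pow_succ', mul_assoc] using this
  obtain ⟨R, hR⟩ := hK.isBounded.subset_closedBall 0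
  obtain ⟨k, hk⟩ := pow_unbounded_of_one_lt (2 * R / (δ / 2)) one_lt_two
  refine iter k K subset_rfl hK.isClosed hKc fun j => ⟨-R, fun x hx => ?_⟩
  have h1 : ‖x‖ ≤ R := by simpa using hR hx
  have h2 := abs_le.1 ((norm_le_pi_norm x j).trans h1)
  rw [div_lt_iff₀ (by positivity)] at hk
  exact ⟨h2.1, by linarith [h2.2]⟩

end Splitting

/-! ### Triviality of circle bundles over the 3-sphere -/

section Sphere

/-- Rescaling to norm `R`. -/
noncomputable def scaleTo {E : Type*} [NormedAddCommGroup E] [NormedSpace ℝ E] (R : ℝ) (x : E) :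
    E := (R / ‖x‖) • x

section

variable {E : Type*} [NormedAddCommGroup E] [NormedSpace ℝ E]

theorem norm_scaleTo {R : ℝ} (hR : 0 ≤ R) {x : E} (hx : x ≠ 0) : ‖scaleTo R x‖ = R := by
  have : ‖x‖ ≠ 0 := norm_ne_zero_iff.2 hx
  rw [scaleTo, norm_smul, Real.norm_of_nonneg (by positivity)]
  field_simp

theorem scaleTo_of_norm_eq {R : ℝ} (hR : 0 < R) {x : E} (hx : ‖x‖ = R) : scaleTo R x = x := by
  rw [scaleTo, hx, div_self hR.ne', one_smul]

theorem scaleTo_smul {R c : ℝ} (hc : 0 < c) (x : E) : scaleTo R (c • x) = scaleTo R x := by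
  rw [scaleTo, scaleTo, norm_smul, Real.norm_of_nonneg hc.le, smul_smul]
  congr 1
  rcases eq_or_ne ‖x‖ 0 with h | h
  · simp [h]
  · field_simp

theorem continuousOn_scaleTo (R : ℝ) : ContinuousOn (scaleTo R : E → E) {x | x ≠ 0} := by
  unfold scaleTo
  exact (continuousOn_const.div continuous_norm.continuousOn
    fun x hx => norm_ne_zero_iff.2 hx).smul continuousOn_id

end

/-- The norm is the sup norm, so the sphere is the surface of a cube. The half contracts to its pole
along straight segments rescaled to norm `R`; the sign of the zeroth coordinate keeps the segments
off the origin. -/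
theorem isLiftingSet_hemisphere {R σ : ℝ} (hR : 0 < R) (hσ : σ ≠ 0) :
    IsLiftingSet (sphere (0 : Fin 3 → ℝ) R ∩ {x | 0 ≤ σ * x 0}) := by
  have hne : ∀ t ∈ Icc (0 : ℝ) 1, ∀ x ∈ sphere (0 : Fin 3 → ℝ) R ∩ {x | 0 ≤ σ * x 0},
      (1 - t) • Pi.single 0 σ + t • x ≠ 0 := by
    rintro t ⟨h0, h1⟩ x ⟨hx, hx0⟩ h
    have hx' : ‖x‖ = R := by simpa using hx
    rcases h1.eq_or_lt with rfl | h1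
    · have : x = 0 := by simpa using h
      rw [this, norm_zero] at hx'
      exact hR.ne hx'
    · have h2 := congrFun h 0
      simp at h2
      have h3 : (1 - t) * σ ^ 2 + t * (σ * x 0) = 0 := by linear_combination σ * h2
      have h4 : 0 < (1 - t) * σ ^ 2 := mul_pos (by linarith) (by positivity)
      have h5 : 0 ≤ t * (σ * x 0) := mul_nonneg h0 hx0
      linarith
  refine isLiftingSet_of_contraction
    (fun t x => scaleTo R ((1 - t) • Pi.single 0 σ + t • x)) (scaleTo R (Pi.single 0 σ)) ?_ ?_ ?_ ?_
  · exact (continuousOn_scaleTo R).comp (by fun_prop) fun p hp => hne p.1 hp.1 p.2 hp.2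
  · intro t ht x hx
    refine ⟨by simpa using norm_scaleTo hR.le (hne t ht x hx), ?_⟩
    have h1 : 0 ≤ (1 - t) * σ ^ 2 := mul_nonneg (by linarith [ht.2]) (by positivity)
    have h2 : 0 ≤ t * (σ * x 0) := mul_nonneg ht.1 hx.2
    simp only [scaleTo, mem_ofPred_eq, Pi.smul_apply, Pi.add_apply, Pi.single_eq_same, smul_eq_mul]
    rw [mul_left_comm]
    refine mul_nonneg (by positivity) ?_
    linarith
  · intro x _
    simp
  · intro x hx
    simpa using scaleTo_of_norm_eq hR (by simpa using hx.1)

theorem isPreconnected_equator {R : ℝ} (hR : 0 < R) :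
    IsPreconnected (sphere (0 : Fin 3 → ℝ) R ∩ {x | x 0 = 0}) := by
  have hne : ∀ θ : ℝ, (![0, Real.cos θ, Real.sin θ] : Fin 3 → ℝ) ≠ 0 := by
    intro θ h
    have h1 := congrFun h 1
    have h2 := congrFun h 2
    simp at h1 h2
    have := Real.cos_sq_add_sin_sq θ
    simp [h1, h2] at this
  have : sphere (0 : Fin 3 → ℝ) R ∩ {x | x 0 = 0} =
      range (fun θ : ℝ => scaleTo R (![0, Real.cos θ, Real.sin θ] : Fin 3 → ℝ)) := by
    ext x
    constructor
    · rintro ⟨hx, hx0⟩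
      have hx' : ‖x‖ = R := by simpa using hx
      let z : ℂ := ⟨x 1, x 2⟩
      have hz : 0 < ‖z‖ := by
        rw [norm_pos_iff]
        intro h
        have h1 : x 1 = 0 := congrArg Complex.re h
        have h2 : x 2 = 0 := congrArg Complex.im h
        have : x = 0 := by
          ext i
          fin_cases i
          · exact hx0
          · exact h1
          · exact h2
        rw [this, norm_zero] at hx'
        exact hR.ne hx'
      refine ⟨z.arg, ?_⟩
      dsimp only
      rw [← scaleTo_smul hz]
      have : (‖z‖ • ![0, Real.cos z.arg, Real.sin z.arg] : Fin 3 → ℝ) = x := by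
        ext i
        fin_cases i
        · simpa using hx0.symm
        · exact Complex.norm_mul_cos_arg z
        · exact Complex.norm_mul_sin_arg z
      rw [this]
      exact scaleTo_of_norm_eq hR hx'
    · rintro ⟨θ, rfl⟩
      refine ⟨by simpa using norm_scaleTo hR.le (hne θ), by simp [scaleTo]⟩
  rw [this]
  refine isPreconnected_range ?_
  refine (continuousOn_scaleTo R).comp_continuous ?_ hne
  refine continuous_pi fun i => ?_
  fin_cases i
  · exact continuous_const
  · exact Real.continuous_cos
  · exact Real.continuous_sin

theorem isLiftingSet_sphere {R : ℝ} (hR : 0 < R) :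
    IsLiftingSet (sphere (0 : Fin 3 → ℝ) R) := by
  have c : ∀ σ : ℝ, IsClosed (sphere (0 : Fin 3 → ℝ) R ∩ {x | 0 ≤ σ * x 0}) := fun σ =>
    isClosed_sphere.inter (isClosed_le continuous_const (by fun_prop))
  have := (isLiftingSet_hemisphere hR one_ne_zero).union
    (isLiftingSet_hemisphere hR (neg_ne_zero.2 one_ne_zero)) (c _) (c _) (by
      convert! isPreconnected_equator hR using 1
      ext x
      simp only [mem_inter_iff, mem_ofPred_eq]
      constructor
      · rintro ⟨⟨h1, h2⟩, -, h3⟩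
        exact ⟨h1, by linarith⟩
      · rintro ⟨h1, h2⟩
        simp [h2]
        simpa using h1)
  convert! this using 1
  ext x
  simp only [mem_union, mem_inter_iff, mem_ofPred_eq, ← and_or_left]
  refine ⟨fun h => ⟨h, ?_⟩, fun h => h.1⟩
  rcases le_total 0 (x 0) with h | h
  · exact Or.inl (by linarith)
  · exact Or.inr (by linarith)

/-- Every circle-valued transition function for an open cover of the 3-sphere by two sets splits:
circle bundles over the 3-sphere are trivial. -/
theorem splitsOn_S3 {u : S3 → Circle} {U₁ U₂ : Set S3} (hU : U₁ ∪ U₂ = univ) (o₁ : IsOpen U₁)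
    (o₂ : IsOpen U₂) (hu : ContinuousOn u (U₁ ∩ U₂)) : SplitsOn u U₁ U₂ univ := by
  let p : S3 := ⟨EuclideanSpace.single 0 1, by simp⟩
  let φ : (Fin 3 → ℝ) → S3 := fun x => (stereographic' 3 p).symm (WithLp.toLp 2 x)
  have hφ : Topology.IsOpenEmbedding φ :=
    ((stereographic' 3 p).symm.isOpenEmbedding (by simp)).comp
      (PiLp.homeomorph 2 fun _ : Fin 3 => ℝ).symm.isOpenEmbedding
  have hran : range φ = {p}ᶜ := by
    have h1 : range φ = range (stereographic' 3 p).symm :=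
      (PiLp.homeomorph 2 fun _ : Fin 3 => ℝ).symm.surjective.range_comp _
    have h2 := (stereographic' 3 p).symm.image_source_eq_target
    rw [h1, ← image_univ]
    simpa using h2
  -- Near the projection point `p` one of the two sets covers everything, so the splitting there is
  -- trivial. What remains lies in a compact ball of the stereographic chart, and the two regions
  -- overlap in a 2-sphere, a lifting set.
  obtain ⟨U, hUo, hpU, hsub⟩ : ∃ U : Set S3, IsOpen U ∧ p ∈ U ∧ (U ⊆ U₁ ∨ U ⊆ U₂) := by
    have : p ∈ U₁ ∪ U₂ := hU ▸ mem_univ p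
    rcases this with h | h
    · exact ⟨U₁, o₁, h, Or.inl subset_rfl⟩
    · exact ⟨U₂, o₂, h, Or.inr subset_rfl⟩
  have hcpt : IsCompact (φ ⁻¹' Uᶜ) := by
    refine hφ.isInducing.isCompact_preimage' hUo.isClosed_compl.isCompact ?_
    rw [hran]
    rintro x hx rfl
    exact hx hpU
  obtain ⟨R, hRpos, hR⟩ := hcpt.isBounded.subset_ball_lt 0 0
  have hS : SplitsOn u U₁ U₂ (φ '' closedBall 0 R) := by
    refine SplitsOn.image hφ.isEmbedding (SplitsOn.of_isCompact_convex ?_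
      (o₁.preimage hφ.continuous) (o₂.preimage hφ.continuous) ?_ (isCompact_closedBall 0 R)
      (convex_closedBall 0 R))
    · rw [← preimage_union, hU, preimage_univ]
    · exact hu.comp hφ.continuous.continuousOn fun x hx => hx
  have hTU : (φ '' ball 0 R)ᶜ ⊆ U := by
    intro x hx
    by_contra hxU
    have : x ∈ range φ := by
      rw [hran]
      rintro rfl
      exact hxU hpU
    obtain ⟨y, rfl⟩ := this
    exact hx ⟨y, hR hxU, rfl⟩
  have hT : SplitsOn u U₁ U₂ (φ '' ball 0 R)ᶜ :=
    SplitsOn.of_subset hu (hsub.imp hTU.trans hTU.trans)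
  have := hS.union hU o₁ o₂ hT ((isCompact_closedBall 0 R).image hφ.continuous).isClosed
    (hφ.isOpenMap _ isOpen_ball).isClosed_compl (by
      rw [← sdiff_eq, ← image_sdiff hφ.injective, closedBall_sdiff_ball]
      exact (isLiftingSet_sphere hRpos).image hφ.isEmbedding)
  refine this.mono fun x _ => ?_
  by_cases hx : x ∈ φ '' ball 0 R
  · exact Or.inl (image_mono ball_subset_closedBall hx)
  · exact Or.inr hx

end Sphere

/-! ### Tubular neighbourhoods -/

/-- The direction of a nonzero complex number. -/
noncomputable def phase (z : ℂ) : Circle :=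
  if h : z = 0 then 1 else ⟨z / ‖z‖, mem_sphere_zero_iff_norm.2 (by simp [h])⟩

theorem coe_phase {z : ℂ} (hz : z ≠ 0) : (phase z : ℂ) = z / ‖z‖ := by
  simp [phase, hz]

theorem isEmbedding_circle_coe : Topology.IsEmbedding (X := Circle) (fun z => (z : ℂ)) :=
  ⟨⟨rfl⟩, Circle.coe_injective⟩

theorem continuousOn_phase : ContinuousOn phase {z | z ≠ 0} := by
  rw [isEmbedding_circle_coe.isInducing.continuousOn_iff]
  refine ContinuousOn.congr (f := fun z : ℂ => z / ‖z‖) ?_ fun z hz => coe_phase hz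
  exact continuousOn_id.div (by fun_prop) fun z hz => by simpa using hz

theorem phase_coe (w : Circle) : phase w = w := by
  ext
  simp [coe_phase (Circle.coe_ne_zero w), Circle.norm_coe]

/-- `τ` is a topological parametrization of a tubular neighbourhood `V` of `K`. -/
structure IsTubularChart (τ : Circle × ℂ → S3) (V K : Set S3) : Prop where
  isOpenEmbedding : Topology.IsOpenEmbedding τ
  image_tube : τ '' {p | ‖p.2‖ ≤ 1} = V
  image_core : τ '' {p | p.2 = 0} = K

theorem IsTubularNhd.exists_isTubularChart {V K : Set S3} (h : IsTubularNhd V K) :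
    ∃ τ, IsTubularChart τ V K := by
  obtain ⟨τ, hi, hd, hV, hK⟩ := h
  exact ⟨τ, hd.isLocalHomeomorph.isOpenEmbedding_of_injective hi, hV, hK⟩

namespace IsTubularChart

variable {τ : Circle × ℂ → S3} {V K : Set S3} (h : IsTubularChart τ V K)

include h

theorem continuous : Continuous τ := h.isOpenEmbedding.continuous

theorem injective : Function.Injective τ := h.isOpenEmbedding.injective

theorem mem_tube {p : Circle × ℂ} : τ p ∈ V ↔ ‖p.2‖ ≤ 1 := by
  rw [← h.image_tube, h.injective.mem_set_image]
  rfl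

theorem mem_core {p : Circle × ℂ} : τ p ∈ K ↔ p.2 = 0 := by
  rw [← h.image_core, h.injective.mem_set_image]
  rfl

theorem mem_interior {p : Circle × ℂ} : τ p ∈ interior V ↔ ‖p.2‖ < 1 := by
  have h1 : τ ⁻¹' V = Prod.snd ⁻¹' closedBall (0 : ℂ) 1 := by
    ext q
    simp [h.mem_tube]
  have h2 : τ ⁻¹' interior V = Prod.snd ⁻¹' ball (0 : ℂ) 1 := by
    rw [h.isOpenEmbedding.isOpenMap.preimage_interior_eq_interior_preimage h.continuous, h1,
      ← isOpenMap_snd.preimage_interior_eq_interior_preimage continuous_snd,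
      interior_closedBall _ one_ne_zero]
  have := Set.ext_iff.1 h2 p
  simpa using this

theorem isCompact_tube : IsCompact V := by
  rw [← h.image_tube]
  have : {p : Circle × ℂ | ‖p.2‖ ≤ 1} = univ ×ˢ closedBall 0 1 := by
    ext p
    simp
  rw [this]
  exact (isCompact_univ.prod (isCompact_closedBall 0 1)).image h.continuous

theorem isClosed_tube : IsClosed V := h.isCompact_tube.isClosed

theorem isClosed_core : IsClosed K := by
  rw [← h.image_core]
  have : {p : Circle × ℂ | p.2 = 0} = univ ×ˢ {0} := by
    ext p
    simp
  rw [this]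
  exact ((isCompact_univ.prod isCompact_singleton).image h.continuous).isClosed

theorem core_subset_interior : K ⊆ interior V := by
  intro x hx
  obtain ⟨p, hp, rfl⟩ := h.image_core.symm ▸ hx
  rw [h.mem_interior, show p.2 = 0 from hp]
  simp

theorem exists_of_mem_tube {x : S3} (hx : x ∈ V) : ∃ p : Circle × ℂ, ‖p.2‖ ≤ 1 ∧ τ p = x := by
  rw [← h.image_tube] at hx
  exact hx

theorem mem_frontier {p : Circle × ℂ} : τ p ∈ frontier V ↔ ‖p.2‖ = 1 := by
  rw [h.isClosed_tube.frontier_eq, mem_sdiff, h.mem_tube, h.mem_interior, not_lt]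
  exact ⟨fun h => le_antisymm h.1 h.2, fun h => ⟨h.le, h.ge⟩⟩

theorem leftInverse : Function.LeftInverse (Function.invFun τ) τ :=
  Function.leftInverse_invFun h.injective

theorem continuousOn_invFun : ContinuousOn (Function.invFun τ) (range τ) := by
  rintro _ ⟨p, rfl⟩
  refine ContinuousAt.continuousWithinAt ?_
  rw [← h.isOpenEmbedding.continuousAt_iff, h.leftInverse.comp_eq_id]
  exact continuousAt_id

/-- The parametrization of the boundary torus. -/
noncomputable def boundaryTorus : Circle × Circle ≃ₜ ↥(frontier V) :=
  Continuous.homeoOfEquivCompactToT2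
    (f := Equiv.ofBijective (fun p : Circle × Circle =>
      (⟨τ (p.1, p.2), h.mem_frontier.2 (Circle.norm_coe _)⟩ : ↥(frontier V))) (by
        constructor
        · intro p q hpq
          have := h.injective (congrArg Subtype.val hpq)
          simp only [Prod.mk.injEq, Circle.coe_inj] at this
          exact Prod.ext this.1 this.2
        · rintro ⟨x, hx⟩
          obtain ⟨p, -, rfl⟩ := h.exists_of_mem_tube (h.isClosed_tube.frontier_subset hx)
          exact ⟨(p.1, ⟨p.2, mem_sphere_zero_iff_norm.2 (h.mem_frontier.1 hx)⟩), rfl⟩))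
    (by
      refine Continuous.subtype_mk ?_ _
      exact h.continuous.comp (by fun_prop))

theorem boundaryTorus_apply (p : Circle × Circle) :
    (h.boundaryTorus p : S3) = τ (p.1, (p.2 : ℂ)) := rfl

/-- The complement of a tame knot carries a circle-valued function of degree one on the meridian. -/
theorem exists_degree_one_on_meridian : ∃ α : S3 → Circle, ContinuousOn α Kᶜ ∧
    ∃ k : C(Circle, ℝ), ∀ w : Circle, Circle.exp (k w) = α (τ (1, (w : ℂ))) * w⁻¹ := by
  -- The angular coordinate around `K` serves as transition function for the cover by `Kᶜ` and the
  -- open tube. Its factor `a` on `Kᶜ` is the required function.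
  have hu : ContinuousOn (fun x => phase (Function.invFun τ x).2) (Kᶜ ∩ range τ) := by
    refine continuousOn_phase.comp
      (continuous_snd.comp_continuousOn (h.continuousOn_invFun.mono inter_subset_right)) ?_
    rintro _ ⟨hx, p, rfl⟩
    change (Function.invFun τ (τ p)).2 ≠ 0
    rw [h.leftInverse p]
    exact fun hp => hx (h.mem_core.2 hp)
  obtain ⟨a, b, ha, hb, hab⟩ := splitsOn_S3 (by
    refine eq_univ_of_forall fun x => ?_
    by_cases hx : x ∈ K
    · obtain ⟨p, -, rfl⟩ := h.image_core.symm ▸ hx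
      exact Or.inr ⟨p, rfl⟩
    · exact Or.inl hx) h.isClosed_core.isOpen_compl h.isOpenEmbedding.isOpen_range hu
  rw [univ_inter] at ha hb
  -- The factor `b` is defined on the whole meridian disc, hence lifts there; so on the meridian `a`
  -- differs from the angle by a liftable map.
  let c : C(ℂ, Circle) := ⟨fun z => b (τ (1, z)),
    hb.comp_continuous (h.continuous.comp (by fun_prop)) fun z => ⟨_, rfl⟩⟩
  obtain ⟨k, hk⟩ := mem_liftable_of_convex c
  refine ⟨a, ha, -(k.comp ⟨fun w : Circle => (w : ℂ), by fun_prop⟩), fun w => ?_⟩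
  have := hab (τ (1, w)) (mem_univ _) (fun hw => Circle.coe_ne_zero w (h.mem_core.1 hw)) ⟨_, rfl⟩
  dsimp only at this
  rw [h.leftInverse, phase_coe] at this
  have hb' : a (τ (1, (w : ℂ))) * w⁻¹ = (b (τ (1, (w : ℂ))))⁻¹ := by
    rw [mul_inv_eq_iff_eq_mul, eq_inv_mul_iff_mul_eq, mul_comm, this]
  rw [hb']
  exact (Circle.exp_neg _).trans (congrArg _ (hk _))

/-- A circle-valued map on the boundary of a tubular neighbourhood that kills an essential curve,
null-homologous in the exterior, extends to the exterior. -/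
theorem exists_extension_to_exterior (ℓ : C(Circle, ↥(frontier V))) (hess : ¬ ℓ.Nullhomotopic)
    (hnull : NullHomologous ((boundaryInclusion V).comp ℓ)) (f : C(↥(frontier V), Circle))
    (hf : f.comp ℓ ∈ liftable Circle) :
    ∃ F : S3 → Circle, ContinuousOn F (interior V)ᶜ ∧ ∀ x : ↥(frontier V), F x = f x := by
  obtain ⟨α, hα, k, hk⟩ := h.exists_degree_one_on_meridian
  have hαE : ContinuousOn α (interior V)ᶜ := hα.mono (compl_subset_compl.2 h.core_subset_interior)
  let αE : C(Exterior V, Circle) := ⟨fun x => α x, continuousOn_iff_continuous_domRestrict.1 hαE⟩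
  let e : C(Circle × Circle, ↥(frontier V)) := h.boundaryTorus
  let e' : C(↥(frontier V), Circle × Circle) := h.boundaryTorus.symm
  have hee' : e.comp e' = ContinuousMap.id _ := by
    ext x
    simp [e, e']
  obtain ⟨n, k', hk'⟩ := exists_zpow_mul_mem_liftable
    (α := (αE.comp (boundaryInclusion V)).comp e) (f := f.comp e) (ℓ := e'.comp ℓ)
    (fun hn => hess (by
      have := hn.comp_right e
      rwa [← ContinuousMap.comp_assoc, hee', ContinuousMap.id_comp] at this))
    (by
      rw [ContinuousMap.comp_assoc, ← ContinuousMap.comp_assoc e, hee', ContinuousMap.id_comp,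
        ContinuousMap.comp_assoc]
      exact hnull.comp_mem_liftable αE)
    (by rwa [ContinuousMap.comp_assoc, ← ContinuousMap.comp_assoc e, hee', ContinuousMap.id_comp])
    ⟨k, fun w => hk w⟩
  -- On the boundary `f` is `exp k'` times `α ^ n`; the second factor already lives on the exterior
  -- and the first extends by Tietze.
  obtain ⟨H, hH⟩ := ContinuousMap.exists_restrict_eq isClosed_frontier (k'.comp e')
  refine ⟨fun x => Circle.exp (H x) * α x ^ n, ?_, fun x => ?_⟩
  · exact (show Continuous fun x => Circle.exp (H x) by fun_prop).continuousOn.mul (hαE.zpow n)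
  · have h1 : H x = k' (e' x) := congrArg (fun g : C(↥(frontier V), ℝ) => g x) hH
    have h2 : e (e' x) = x := congrArg (fun g : C(↥(frontier V), ↥(frontier V)) => g x) hee'
    have h3 := hk' (e' x)
    simp only [ContinuousMap.mul_apply, ContinuousMap.comp_apply, ContinuousMap.inv_apply,
      ContinuousMap.zpow_apply, h2] at h3
    dsimp only
    rw [h1, h3]
    exact inv_mul_cancel_right (f x) (α x ^ n)

end IsTubularChart

/-! ### Radial retraction to the exterior -/

open Classical in
/-- The radial deformation of the complement of the core to the exterior of the tube. -/
noncomputable def radialPush (τ : Circle × ℂ → S3) (V : Set S3) (t : ℝ) (x : S3) : S3 :=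
  if x ∈ V then
    τ ((Function.invFun τ x).1,
      ((1 - t) + t * ‖(Function.invFun τ x).2‖⁻¹ : ℝ) • (Function.invFun τ x).2)
  else x

namespace IsTubularChart

variable {τ : Circle × ℂ → S3} {V K : Set S3} (h : IsTubularChart τ V K)

include h

theorem radialPush_apply (t : ℝ) {p : Circle × ℂ} (hp : ‖p.2‖ ≤ 1) :
    radialPush τ V t (τ p) = τ (p.1, ((1 - t) + t * ‖p.2‖⁻¹ : ℝ) • p.2) := by
  rw [radialPush, if_pos (h.mem_tube.2 hp), h.leftInverse]

theorem radialPush_of_notMem_interior (t : ℝ) {x : S3} (hx : x ∉ interior V) :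
    radialPush τ V t x = x := by
  by_cases hV : x ∈ V
  · obtain ⟨p, hp, rfl⟩ := h.exists_of_mem_tube hV
    rw [h.mem_interior, not_lt] at hx
    simp [h.radialPush_apply t hp, le_antisymm hp hx]
  · exact if_neg hV

theorem radialPush_zero (x : S3) : radialPush τ V 0 x = x := by
  by_cases hV : x ∈ V
  · obtain ⟨p, hp, rfl⟩ := h.exists_of_mem_tube hV
    simp [h.radialPush_apply 0 hp]
  · exact if_neg hV

theorem radialPush_notMem_core {t : ℝ} (ht : t ∈ Icc (0 : ℝ) 1) {x : S3} (hx : x ∉ K) :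
    radialPush τ V t x ∉ K := by
  by_cases hV : x ∈ V
  · obtain ⟨p, hp, rfl⟩ := h.exists_of_mem_tube hV
    rw [h.mem_core] at hx
    rw [h.radialPush_apply t hp, h.mem_core]
    have h0 : 0 < ‖p.2‖ := norm_pos_iff.2 hx
    have h1 : 1 ≤ ‖p.2‖⁻¹ := (one_le_inv₀ h0).2 hp
    have h2 : 0 < (1 - t) + t * ‖p.2‖⁻¹ := by nlinarith [ht.1, ht.2]
    exact smul_ne_zero h2.ne' hx
  · rwa [radialPush, if_neg hV]

theorem radialPush_one_notMem_interior {x : S3} (hx : x ∉ K) :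
    radialPush τ V 1 x ∉ interior V := by
  by_cases hV : x ∈ V
  · obtain ⟨p, hp, rfl⟩ := h.exists_of_mem_tube hV
    rw [h.mem_core] at hx
    have h0 : ‖p.2‖ ≠ 0 := norm_ne_zero_iff.2 hx
    simp [h.radialPush_apply 1 hp, h.mem_interior, h0]
  · rw [radialPush, if_neg hV]
    exact fun hi => hV (interior_subset hi)

theorem radialPush_one_mem_frontier {x : S3} (hx : x ∉ K) (hV : x ∈ V) :
    radialPush τ V 1 x ∈ frontier V := by
  rw [h.isClosed_tube.frontier_eq]
  refine ⟨?_, h.radialPush_one_notMem_interior hx⟩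
  obtain ⟨p, hp, rfl⟩ := h.exists_of_mem_tube hV
  rw [h.mem_core] at hx
  have h0 : ‖p.2‖ ≠ 0 := norm_ne_zero_iff.2 hx
  simp [h.radialPush_apply 1 hp, h.mem_tube, h0]

theorem continuousOn_radialPush :
    ContinuousOn (fun q : ℝ × S3 => radialPush τ V q.1 q.2) (univ ×ˢ Kᶜ) := by
  have hcl : IsClosed (univ ×ˢ V : Set (ℝ × S3)) := isClosed_univ.prod h.isClosed_tube
  have hcl' : IsClosed (univ ×ˢ (interior V)ᶜ : Set (ℝ × S3)) :=
    isClosed_univ.prod isOpen_interior.isClosed_compl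
  refine (continuousOn_union_inter (U := univ ×ˢ Kᶜ) hcl hcl' ?_ ?_).mono ?_
  · have hinv : ContinuousOn (fun q : ℝ × S3 => Function.invFun τ q.2)
        (univ ×ˢ V ∩ univ ×ˢ Kᶜ) := by
      refine h.continuousOn_invFun.comp continuousOn_snd ?_
      rintro q ⟨⟨-, hq⟩, -⟩
      obtain ⟨p, -, hp⟩ := h.exists_of_mem_tube hq
      exact ⟨p, hp⟩
    have hz : ContinuousOn (fun q : ℝ × S3 => (Function.invFun τ q.2).2)
        (univ ×ˢ V ∩ univ ×ˢ Kᶜ) := continuous_snd.comp_continuousOn hinv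
    have hne : ∀ q ∈ (univ ×ˢ V ∩ univ ×ˢ Kᶜ : Set (ℝ × S3)),
        ‖(Function.invFun τ q.2).2‖ ≠ 0 := by
      rintro ⟨t, x⟩ ⟨⟨-, hq⟩, -, hqK⟩
      obtain ⟨p, -, rfl⟩ := h.exists_of_mem_tube hq
      rw [h.leftInverse, norm_ne_zero_iff]
      exact fun hp => hqK (h.mem_core.2 hp)
    refine ContinuousOn.congr (f := fun q : ℝ × S3 => τ ((Function.invFun τ q.2).1,
      ((1 - q.1) + q.1 * ‖(Function.invFun τ q.2).2‖⁻¹ : ℝ) • (Function.invFun τ q.2).2)) ?_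
      fun q hq => if_pos hq.1.2
    refine h.continuous.comp_continuousOn ((continuous_fst.comp_continuousOn hinv).prodMk ?_)
    exact ((continuousOn_const.sub continuousOn_fst).add
      (continuousOn_fst.mul (hz.norm.inv₀ hne))).smul hz
  · refine continuousOn_snd.congr fun q hq => ?_
    exact h.radialPush_of_notMem_interior q.1 hq.1.2
  · rintro ⟨t, x⟩ hq
    refine ⟨?_, hq⟩
    by_cases hV : x ∈ V
    · exact Or.inl ⟨mem_univ _, hV⟩
    · exact Or.inr ⟨mem_univ _, fun hi => hV (interior_subset hi)⟩

end IsTubularChart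

/-! ### Solid torus coordinates on the 3-sphere -/

/-- Complex coordinates `z`, `w` on the 3-sphere, with the radial projection `M` onto it, in which
`V` is the solid torus `‖w‖ ≤ ‖z‖`. -/
structure IsSolidTorusCoords (V : Set S3) (z w : S3 → ℂ) (M : ℂ → ℂ → S3) : Prop where
  continuous_z : Continuous z
  continuous_w : Continuous w
  continuousOn_M : ContinuousOn (fun q : ℂ × ℂ => M q.1 q.2) {q | q ≠ 0}
  mem_iff : ∀ x, x ∈ V ↔ ‖w x‖ ≤ ‖z x‖
  mem_interior : ∀ x, x ∈ interior V ↔ ‖w x‖ < ‖z x‖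
  ne_zero : ∀ x, (z x, w x) ≠ 0
  M_coords : ∀ x, M (z x) (w x) = x
  M_smul : ∀ c : ℝ, 0 < c → ∀ a b, M (c • a) (c • b) = M a b
  coords_M : ∀ a b, (a, b) ≠ 0 → ∃ r : ℝ, 0 < r ∧ z (M a b) = r • a ∧ w (M a b) = r • b

/-- The vector of `ℝ⁴` with complex coordinates `a` and `b`. -/
def pairVec (a b : ℂ) : EuclideanSpace ℝ (Fin 4) := !₂[a.re, a.im, b.re, b.im]

theorem pairVec_ne_zero {a b : ℂ} (h : (a, b) ≠ 0) : pairVec a b ≠ 0 := by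
  intro h0
  apply h
  have e : ∀ i, pairVec a b i = 0 := fun i => by rw [h0]; rfl
  have h0 := e 0
  have h1 := e 1
  have h2 := e 2
  have h3 := e 3
  simp [pairVec] at h0 h1 h2 h3
  exact Prod.ext (Complex.ext h0 h1) (Complex.ext h2 h3)

open Classical in
/-- The radial projection of a nonzero pair of complex numbers to the 3-sphere. -/
noncomputable def pairToS3 (a b : ℂ) : S3 :=
  if h : (a, b) ≠ 0 then
    ⟨scaleTo 1 (pairVec a b), by simpa using norm_scaleTo zero_le_one (pairVec_ne_zero h)⟩
  else ⟨EuclideanSpace.single 0 1, by simp⟩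

/-- The first complex coordinate. -/
def cliffordZ (x : S3) : ℂ := ⟨x.1 0, x.1 1⟩

/-- The second complex coordinate. -/
def cliffordW (x : S3) : ℂ := ⟨x.1 2, x.1 3⟩

theorem continuous_mk_complex {X : Type*} [TopologicalSpace X] {f g : X → ℝ} (hf : Continuous f)
    (hg : Continuous g) : Continuous (fun x => (⟨f x, g x⟩ : ℂ)) :=
  Complex.equivRealProdCLM.symm.continuous.comp (hf.prodMk hg)

theorem pairVec_clifford (x : S3) : pairVec (cliffordZ x) (cliffordW x) = x.1 := by
  ext i
  fin_cases i <;> rfl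

theorem pairVec_smul (c : ℝ) (a b : ℂ) : pairVec (c • a) (c • b) = c • pairVec a b := by
  ext i
  fin_cases i <;> simp [pairVec]

theorem continuous_pairVec : Continuous fun q : ℂ × ℂ => pairVec q.1 q.2 := by
  unfold pairVec
  refine (PiLp.continuous_toLp 2 _).comp (continuous_pi fun i => ?_)
  fin_cases i
  · exact Complex.continuous_re.comp continuous_fst
  · exact Complex.continuous_im.comp continuous_fst
  · exact Complex.continuous_re.comp continuous_snd
  · exact Complex.continuous_im.comp continuous_snd

theorem mem_cliffordSolidTorus (x : S3) :
    x ∈ cliffordSolidTorus ↔ ‖cliffordW x‖ ≤ ‖cliffordZ x‖ := by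
  rw [← sq_le_sq₀ (norm_nonneg _) (norm_nonneg _), ← Complex.normSq_eq_norm_sq,
    ← Complex.normSq_eq_norm_sq, Complex.normSq_apply, Complex.normSq_apply]
  simp only [cliffordSolidTorus, mem_ofPred_eq, cliffordZ, cliffordW, sq]

theorem clifford_ne_zero (x : S3) : (cliffordZ x, cliffordW x) ≠ 0 := by
  intro h
  have h1 : cliffordZ x = 0 := congrArg Prod.fst h
  have h2 : cliffordW x = 0 := congrArg Prod.snd h
  have h3 := pairVec_clifford x
  rw [h1, h2] at h3
  have h4 : pairVec 0 0 = 0 := by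
    ext i
    fin_cases i <;> simp [pairVec]
  have h5 : ‖x.1‖ = 1 := by simp
  rw [← h3, h4, norm_zero] at h5
  exact zero_ne_one h5

theorem pairToS3_clifford (x : S3) : pairToS3 (cliffordZ x) (cliffordW x) = x := by
  ext1
  rw [pairToS3, dif_pos (clifford_ne_zero x)]
  simp only [pairVec_clifford]
  exact scaleTo_of_norm_eq one_pos (by simp)

theorem clifford_pairToS3 (a b : ℂ) (h : (a, b) ≠ 0) : ∃ r : ℝ, 0 < r ∧
    cliffordZ (pairToS3 a b) = r • a ∧ cliffordW (pairToS3 a b) = r • b := by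
  refine ⟨1 / ‖pairVec a b‖, div_pos one_pos (norm_pos_iff.2 (pairVec_ne_zero h)), ?_, ?_⟩ <;>
  · rw [pairToS3, dif_pos h]
    apply Complex.ext <;> simp [cliffordZ, cliffordW, scaleTo, pairVec]

theorem pairToS3_smul (c : ℝ) (hc : 0 < c) (a b : ℂ) :
    pairToS3 (c • a) (c • b) = pairToS3 a b := by
  by_cases h : (a, b) ≠ 0
  · have h' : (c • a, c • b) ≠ 0 := by
      rw [← Prod.smul_mk]
      exact smul_ne_zero hc.ne' h
    ext1
    simp only [pairToS3, dif_pos h, dif_pos h', pairVec_smul, scaleTo_smul hc]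
  · rw [not_not] at h
    obtain ⟨rfl, rfl⟩ := Prod.mk.inj h
    simp

theorem continuousOn_pairToS3 : ContinuousOn (fun q : ℂ × ℂ => pairToS3 q.1 q.2) {q | q ≠ 0} := by
  rw [Topology.IsEmbedding.subtypeVal.isInducing.continuousOn_iff]
  refine ((continuousOn_scaleTo 1).comp continuous_pairVec.continuousOn
    fun q hq => pairVec_ne_zero hq).congr fun q hq => ?_
  have : (q.1, q.2) ≠ 0 := hq
  simp [pairToS3, this]

theorem continuous_cliffordZ : Continuous cliffordZ :=
  continuous_mk_complex (by fun_prop) (by fun_prop)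

theorem continuous_cliffordW : Continuous cliffordW :=
  continuous_mk_complex (by fun_prop) (by fun_prop)

/-- A point with coordinates of equal norm is not interior, since shrinking its `z`-coordinate
slightly moves it out of the torus. -/
theorem mem_interior_cliffordSolidTorus (x : S3) :
    x ∈ interior cliffordSolidTorus ↔ ‖cliffordW x‖ < ‖cliffordZ x‖ := by
  constructor
  · intro hx
    have hle := (mem_cliffordSolidTorus x).1 (interior_subset hx)
    refine hle.lt_of_ne fun heq => ?_
    have hz : cliffordZ x ≠ 0 := by
      intro h
      rw [h, norm_zero, norm_eq_zero] at heq
      exact clifford_ne_zero x (by rw [h, heq]; rfl)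
    have hne : ∀ s : ℝ, (s • cliffordZ x, cliffordW x) ≠ 0 := by
      intro s h
      have h2 : cliffordW x = 0 := congrArg Prod.snd h
      rw [h2, norm_zero, eq_comm, norm_eq_zero] at heq
      exact hz heq
    have hc : Continuous fun s : ℝ => pairToS3 (s • cliffordZ x) (cliffordW x) :=
      continuousOn_pairToS3.comp_continuous (f := fun s : ℝ => (s • cliffordZ x, cliffordW x))
        (by fun_prop) hne
    have hopen : IsOpen {s : ℝ | pairToS3 (s • cliffordZ x) (cliffordW x) ∈
        interior cliffordSolidTorus} := isOpen_interior.preimage hc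
    have h1 : (1 : ℝ) ∈ {s : ℝ | pairToS3 (s • cliffordZ x) (cliffordW x) ∈
        interior cliffordSolidTorus} := by
      simpa [pairToS3_clifford] using hx
    obtain ⟨ε, hε, hball⟩ := Metric.isOpen_iff.1 hopen 1 h1
    have h3 : 0 < min (ε / 2) (1 / 2) := by positivity
    have hs := hball (show 1 - min (ε / 2) (1 / 2) ∈ ball (1 : ℝ) ε by
      rw [mem_ball, Real.dist_eq, sub_sub_cancel_left, abs_neg, abs_of_pos h3]
      exact (min_le_left _ _).trans_lt (by linarith))
    have hs' := (mem_cliffordSolidTorus _).1 (interior_subset hs)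
    obtain ⟨r, hr, e1, e2⟩ := clifford_pairToS3 _ _ (hne (1 - min (ε / 2) (1 / 2)))
    have h2 : min (ε / 2) (1 / 2) ≤ 1 / 2 := min_le_right _ _
    rw [e1, e2, norm_smul, norm_smul, norm_smul, mul_le_mul_iff_right₀ (norm_pos_iff.2 hr.ne'), heq,
      Real.norm_of_nonneg (by linarith)] at hs'
    have := norm_pos_iff.2 hz
    nlinarith
  · intro hx
    refine mem_interior.2 ⟨{y | ‖cliffordW y‖ < ‖cliffordZ y‖}, fun y hy => ?_, ?_, hx⟩
    · exact (mem_cliffordSolidTorus y).2 (le_of_lt hy)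
    · exact isOpen_lt continuous_cliffordW.norm continuous_cliffordZ.norm

theorem IsStandardSolidTorus.exists_coords {V : Set S3} (hV : IsStandardSolidTorus V) :
    ∃ z w M, IsSolidTorusCoords V z w M := by
  obtain ⟨φ, rfl⟩ := hV
  let e : S3 ≃ₜ S3 := φ.toHomeomorph
  have hmem : ∀ (A : Set S3) (x : S3), x ∈ e '' A ↔ e.symm x ∈ A := fun A x => by
    rw [← e.symm_symm, ← Homeomorph.preimage_symm]
    simp
  refine ⟨cliffordZ ∘ e.symm, cliffordW ∘ e.symm, fun a b => e (pairToS3 a b),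
    continuous_cliffordZ.comp e.symm.continuous, continuous_cliffordW.comp e.symm.continuous,
    e.continuous.comp_continuousOn continuousOn_pairToS3, fun x => ?_, fun x => ?_,
    fun x => clifford_ne_zero _, fun x => ?_, fun c hc a b => ?_, fun a b hab => ?_⟩
  · exact (hmem _ x).trans (mem_cliffordSolidTorus _)
  · change x ∈ interior (e '' _) ↔ _
    rw [← e.image_interior]
    exact (hmem _ x).trans (mem_interior_cliffordSolidTorus _)
  · simp [pairToS3_clifford]
  · rw [pairToS3_smul c hc]
  · simpa using clifford_pairToS3 a b hab

namespace IsSolidTorusCoords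

variable {V : Set S3} {z w : S3 → ℂ} {M : ℂ → ℂ → S3} (h : IsSolidTorusCoords V z w M)

include h

theorem isClosed : IsClosed V := by
  have : V = {x | ‖w x‖ ≤ ‖z x‖} := Set.ext h.mem_iff
  rw [this]
  exact isClosed_le h.continuous_w.norm h.continuous_z.norm

theorem w_ne_zero {x : S3} (hx : x ∉ interior V) : w x ≠ 0 := by
  intro hw
  rw [h.mem_interior, not_lt, hw, norm_zero] at hx
  exact h.ne_zero x (by rw [hw, norm_le_zero_iff.1 hx]; rfl)

theorem M_notMem_interior {a b : ℂ} (hb : b ≠ 0) (hab : ‖a‖ ≤ ‖b‖) : M a b ∉ interior V := by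
  obtain ⟨r, hr, e1, e2⟩ := h.coords_M a b (fun h0 => hb (congrArg Prod.snd h0))
  rw [h.mem_interior, e1, e2, norm_smul, norm_smul, not_lt]
  gcongr

theorem M_mem {a b : ℂ} (ha : a ≠ 0) (hab : ‖b‖ ≤ ‖a‖) : M a b ∈ V := by
  obtain ⟨r, hr, e1, e2⟩ := h.coords_M a b (fun h0 => ha (congrArg Prod.fst h0))
  rw [h.mem_iff, e1, e2, norm_smul, norm_smul]
  gcongr

/-- A homeomorphism from the solid torus `V` to a tubular neighbourhood that carries a longitude to
a longitude has an inverse that extends to the 3-sphere, mapping exterior to exterior. -/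
theorem exists_extension_of_inverse {τ : Circle × ℂ → S3} {Vh Kh : Set S3}
    (hτ : IsTubularChart τ Vh Kh) {g : S3 → S3} (hg : ContinuousOn g V) (hgi : InjOn g V)
    (hgV : g '' V = Vh) (hgint : g '' interior V ⊆ interior Vh)
    (hlong : ∃ (lt : C(Circle, ↥(frontier V))) (lh : C(Circle, ↥(frontier Vh))),
      IsLongitude V lt ∧ IsLongitude Vh lh ∧ ∀ t, g (lt t) = lh t) :
    ∃ F : C(S3, S3), (∀ x ∈ V, F (g x) = x) ∧ ∀ x ∉ Vh, F x ∉ interior V := by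
  classical
  have : Nonempty S3 := ⟨M 1 0⟩
  obtain ⟨lt, lh, ⟨-, -, hlt⟩, ⟨-, hlh, hlh'⟩, hglt⟩ := hlong
  let j : S3 → S3 := Function.invFunOn g V
  have hjg : ∀ x ∈ V, j (g x) = x := fun x hx => hgi.leftInvOn_invFunOn hx
  have hsurj : ∀ y ∈ Vh, ∃ x ∈ V, g x = y := fun y hy => by rwa [← hgV] at hy
  have hj : ContinuousOn j Vh := by
    rw [continuousOn_iff_isClosed]
    intro t ht
    refine ⟨g '' (V ∩ t), ((h.isClosed.inter ht).isCompact.image_of_continuousOn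
      (hg.mono inter_subset_left)).isClosed, ?_⟩
    ext y
    constructor
    · rintro ⟨hy1, hy2⟩
      obtain ⟨x, hx, rfl⟩ := hsurj y hy2
      refine ⟨⟨x, ⟨hx, ?_⟩, rfl⟩, hy2⟩
      rwa [mem_preimage, hjg x hx] at hy1
    · rintro ⟨⟨x, ⟨hx, hxt⟩, rfl⟩, hy2⟩
      refine ⟨?_, hy2⟩
      rwa [mem_preimage, hjg x hx]
  have hsub : frontier Vh ⊆ Vh := hτ.isClosed_tube.frontier_subset
  have hjE : ∀ y ∈ frontier Vh, j y ∉ interior V := by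
    intro y hy hi
    obtain ⟨x, hx, rfl⟩ := hsurj y (hsub hy)
    rw [hjg x hx] at hi
    exact hy.2 (hgint ⟨x, hi, rfl⟩)
  have hjF : ContinuousOn j (frontier Vh) := hj.mono hsub
  have hwF : ContinuousOn (fun y => w (j y)) (frontier Vh) := h.continuous_w.comp_continuousOn hjF
  have hzF : ContinuousOn (fun y => z (j y)) (frontier Vh) := h.continuous_z.comp_continuousOn hjF
  have hw0 : ∀ y ∈ frontier Vh, w (j y) ≠ 0 := fun y hy => h.w_ne_zero (hjE y hy)
  let f : C(↥(frontier Vh), Circle) := ⟨fun y => phase (w (j y)),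
    continuousOn_iff_continuous_domRestrict.1 (continuousOn_phase.comp hwF hw0)⟩
  let fE : C(Exterior V, Circle) := ⟨fun x => phase (w x),
    continuousOn_phase.comp_continuous (h.continuous_w.comp continuous_subtype_val)
      fun x => h.w_ne_zero x.2⟩
  -- Along `lh = g ∘ lt` the map `f` is the phase of `w` along `lt`. That phase is defined on the
  -- whole exterior of `V`, where `lt` is null-homologous.
  have hf : f.comp lh ∈ liftable Circle := by
    have : f.comp lh = fE.comp ((boundaryInclusion V).comp lt) := by
      ext1 t
      change phase (w (j (lh t))) = phase (w (lt t))
      rw [← hglt, hjg _ (h.isClosed.frontier_subset (lt t).2)]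
    rw [this]
    exact hlt.comp_mem_liftable fE
  obtain ⟨θ, hθ, hθf⟩ := hτ.exists_extension_to_exterior lh hlh hlh' f hf
  obtain ⟨D, hD⟩ := ContinuousMap.exists_restrict_eq (X := S3) (Y := ℂ) (s := frontier Vh)
    isClosed_frontier ⟨(frontier Vh).domRestrict fun y => z (j y) / ‖w (j y)‖,
      continuousOn_iff_continuous_domRestrict.1
        (hzF.div (Complex.continuous_ofReal.comp_continuousOn hwF.norm) fun y hy => by simpa using hw0 y hy)⟩
  have hD' : ∀ y ∈ frontier Vh, D y = z (j y) / ‖w (j y)‖ := fun y hy =>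
    congrArg (fun f : C(↥(frontier Vh), ℂ) => f ⟨y, hy⟩) hD
  -- Retracts the Tietze extension to the unit disc, which keeps `M (d y) (θ y)` outside the
  -- interior of `V`; on the frontier `‖D y‖ ≤ 1` already, so nothing changes.
  let d : S3 → ℂ := fun y => (max 1 ‖D y‖)⁻¹ • D y
  have hm : ∀ y, 0 < max 1 ‖D y‖ := fun y => lt_max_of_lt_left one_pos
  have hd : Continuous d :=
    ((continuous_const.max D.continuous.norm).inv₀ fun y => (hm y).ne').smul D.continuous
  have hd1 : ∀ y, ‖d y‖ ≤ 1 := by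
    intro y
    rw [norm_smul, norm_inv, Real.norm_of_nonneg (hm y).le, inv_mul_le_one₀ (hm y)]
    exact le_max_right _ _
  let F : S3 → S3 := fun y => if y ∈ Vh then j y else M (d y) (θ y)
  have hF1 : ∀ y ∈ Vh, F y = j y := fun y hy => if_pos hy
  have hF2 : ∀ y ∈ (interior Vh)ᶜ, F y = M (d y) (θ y) := by
    intro y hy
    by_cases hyV : y ∈ Vh
    · have hyF : y ∈ frontier Vh := hτ.isClosed_tube.frontier_eq ▸ ⟨hyV, hy⟩
      have hw : 0 < ‖w (j y)‖ := norm_pos_iff.2 (hw0 y hyF)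
      have hz : ‖z (j y)‖ ≤ ‖w (j y)‖ := by
        have := hjE y hyF
        rwa [h.mem_interior, not_lt] at this
      have e1 : d y = ‖w (j y)‖⁻¹ • z (j y) := by
        have h1 : ‖D y‖ ≤ 1 := by
          rw [hD' y hyF, norm_div, Complex.norm_real, norm_norm]
          exact (div_le_one hw).2 hz
        simp only [d]
        rw [max_eq_left h1, inv_one, one_smul, hD' y hyF, div_eq_inv_mul, Complex.real_smul,
          Complex.ofReal_inv]
      have e2 : (θ y : ℂ) = ‖w (j y)‖⁻¹ • w (j y) := by
        rw [hθf ⟨y, hyF⟩]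
        change (phase (w (j y)) : ℂ) = _
        rw [coe_phase (hw0 y hyF), div_eq_inv_mul, Complex.real_smul, Complex.ofReal_inv]
      rw [hF1 y hyV, e1, e2, h.M_smul _ (inv_pos.2 hw), h.M_coords]
    · exact if_neg hyV
  have hF : Continuous F := by
    rw [← continuousOn_univ]
    refine (continuousOn_union_inter (U := univ) (t := (interior Vh)ᶜ) hτ.isClosed_tube
      isOpen_interior.isClosed_compl ?_ ?_).mono ?_
    · exact (hj.congr hF1).mono inter_subset_left
    · refine ContinuousOn.mono (ContinuousOn.congr ?_ hF2) inter_subset_left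
      refine h.continuousOn_M.comp (f := fun y => (d y, (θ y : ℂ)))
        (hd.continuousOn.prodMk (isEmbedding_circle_coe.continuous.comp_continuousOn hθ)) ?_
      exact fun y _ h0 => Circle.coe_ne_zero _ (congrArg Prod.snd h0)
    · intro y _
      refine ⟨?_, mem_univ _⟩
      by_cases hy : y ∈ Vh
      · exact Or.inl hy
      · exact Or.inr fun hi => hy (interior_subset hi)
  refine ⟨⟨F, hF⟩, fun x hx => ?_, fun y hy => ?_⟩
  · change F (g x) = x
    rw [hF1 _ (hgV ▸ mem_image_of_mem g hx), hjg x hx]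
  · change F y ∉ interior V
    rw [hF2 y fun hi => hy (interior_subset hi)]
    refine h.M_notMem_interior (Circle.coe_ne_zero _) ?_
    rw [Circle.norm_coe]
    exact hd1 y

end IsSolidTorusCoords

/-! ### The collapse of the satellite onto its pattern -/

theorem SatelliteData.image_interior_subset {k kt : Knot} (S : SatelliteData k kt) :
    S.g '' interior S.Vt ⊆ interior S.Vh := by
  refine interior_maximal ((image_mono interior_subset).trans S.image_eq.subset) ?_
  rw [isOpen_iff_mem_nhds]
  rintro _ ⟨x, hx, rfl⟩
  rw [← S.isLocalDiffeomorphOn.isLocalHomeomorphOn.map_nhds_eq (interior_subset hx)]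
  exact Filter.image_mem_map (isOpen_interior.mem_nhds hx)

/-- The degree-one map from the satellite to the pattern. -/
theorem SatelliteData.exists_collapse {k kt : Knot} (S : SatelliteData k kt) :
    ∃ F : C(S3, S3), (∀ x ∈ S.Vt, F (S.g x) = x) ∧ ∀ x, F x ∈ kt.carrier ↔ x ∈ k.carrier := by
  obtain ⟨z, w, M, h⟩ := S.isStandardSolidTorus.exists_coords
  obtain ⟨τ, hτ⟩ := S.isTubularNhd.exists_isTubularChart
  obtain ⟨F, hF1, hF2⟩ := h.exists_extension_of_inverse hτ
    S.isLocalDiffeomorphOn.contMDiffOn.continuousOn S.injOn S.image_eq S.image_interior_subset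
    S.longitude
  refine ⟨F, hF1, fun x => ?_⟩
  have hkt : kt.carrier ⊆ S.Vt := S.pattern_subset.trans interior_subset
  rw [← S.satellite_eq]
  by_cases hx : x ∈ S.Vh
  · rw [← S.image_eq] at hx
    obtain ⟨y, hy, rfl⟩ := hx
    rw [hF1 y hy]
    exact ⟨mem_image_of_mem _, fun ⟨y', hy', e⟩ => S.injOn (hkt hy') hy e ▸ hy'⟩
  · refine ⟨fun h => (hF2 x hx (S.pattern_subset h)).elim, fun h => (hx ?_).elim⟩
    rw [← S.image_eq]
    exact image_mono hkt h

/-! ### Induced maps on fundamental groups -/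

section FundamentalGroup

open CategoryTheory

variable {X Y Z : Type*} [TopologicalSpace X] [TopologicalSpace Y] [TopologicalSpace Z]

open FundamentalGroup

theorem fundamentalGroup_map_comp (g : C(Y, Z)) (f : C(X, Y)) (x : X)
    (γ : FundamentalGroup X x) : map (g.comp f) x γ = map g (f x) (map f x γ) := by
  induction γ using Quotient.inductionOn
  rfl

theorem fundamentalGroup_map_basepoint (f : C(X, Y)) {x x' : X} (p : Path x x')
    (γ : FundamentalGroup X x) :
    map f x' (fundamentalGroupMulEquivOfPath p γ) =
      fundamentalGroupMulEquivOfPath (p.map f.continuous) (map f x γ) :=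
  Functor.map_conj (FundamentalGroupoid.map f) _ _

theorem fundamentalGroup_map_of_homotopy {f g : C(X, Y)} (H : f.Homotopy g) (x : X)
    (γ : FundamentalGroup X x) :
    map g x γ = fundamentalGroupMulEquivOfPath (H.evalAt x) (map f x γ) := by
  have h := (FundamentalGroupoidFunctor.homotopicMapsNatIso H).naturality γ
  let e : FundamentalGroupoid.mk (f x) ⟶ FundamentalGroupoid.mk (g x) :=
    Path.Homotopic.Quotient.mk (H.evalAt x)
  exact ((Iso.inv_comp_eq ((Groupoid.isoEquivHom _ _).symm e)).2 h).symm

theorem surjective_map_of_path {f : C(X, Y)} {x x' : X} (p : Path x x')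
    (h : Function.Surjective (map f x)) : Function.Surjective (map f x') := by
  intro γ
  obtain ⟨γ', rfl⟩ := (fundamentalGroupMulEquivOfPath (p.map f.continuous)).surjective γ
  obtain ⟨δ, rfl⟩ := h γ'
  exact ⟨_, fundamentalGroup_map_basepoint f p δ⟩

theorem surjective_map_of_eq_id {f : C(X, X)} (hf : f = ContinuousMap.id X) (x : X) :
    Function.Surjective (map f x) := by
  subst hf
  intro γ
  refine ⟨γ, ?_⟩
  induction γ using Quotient.inductionOn
  rfl

theorem surjective_map_of_comp {g : C(Y, Z)} {f : C(X, Y)} {x : X}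
    (h : Function.Surjective (map (g.comp f) x)) : Function.Surjective (map g (f x)) := by
  intro γ
  obtain ⟨δ, rfl⟩ := h γ
  exact ⟨_, (fundamentalGroup_map_comp g f x δ).symm⟩

/-- If loops in `B` deform into `A`, rel endpoints, then the inclusion is surjective on
fundamental groups. -/
theorem surjective_map_inclusion {A B : Set X} (hAB : A ⊆ B) (x : A)
    (h : ∀ γ : C(unitInterval, X), (∀ t, γ t ∈ B) → γ 0 = x → γ 1 = x →
      ∃ H : unitInterval × unitInterval → X, Continuous H ∧ (∀ q, H q ∈ B) ∧
        (∀ t, H (0, t) = γ t) ∧ (∀ t, H (1, t) ∈ A) ∧ (∀ s, H (s, 0) = x) ∧ ∀ s, H (s, 1) = x) :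
    Function.Surjective (map (ContinuousMap.inclusion hAB) x) := by
  intro γ
  induction γ using Quotient.inductionOn with | _ γ
  obtain ⟨H, hc, hB, h0, h1, hl, hr⟩ := h ⟨fun t => (γ t : X), by fun_prop⟩ (fun t => (γ t).2)
    (congrArg Subtype.val γ.source) (congrArg Subtype.val γ.target)
  let δ : Path x x :=
    { toFun := fun t => ⟨H (1, t), h1 t⟩
      continuous_toFun := by fun_prop
      source' := Subtype.ext (hl 1)
      target' := Subtype.ext (hr 1) }
  refine ⟨Path.Homotopic.Quotient.mk δ, Quotient.sound ⟨Path.Homotopy.symm ?_⟩⟩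
  exact
    { toFun := fun q => ⟨H q, hB q⟩
      continuous_toFun := by fun_prop
      map_zero_left := fun t => Subtype.ext (h0 t)
      map_one_left := fun t => Subtype.ext rfl
      prop' := by
        rintro s t (rfl | rfl)
        · exact Subtype.ext ((hl s).trans (congrArg Subtype.val γ.source).symm)
        · exact Subtype.ext ((hr s).trans (congrArg Subtype.val γ.target).symm) }

end FundamentalGroup

/-! ### Pushing loops into the solid torus -/

/-- A path in the plane can be approximated by a path that avoids the origin. -/
theorem exists_approx_ne_zero (ζ : C(unitInterval, ℂ)) {ε : ℝ} (hε : 0 < ε) :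
    ∃ p : C(unitInterval, ℂ), ∀ t, p t ≠ 0 ∧ ‖p t - ζ t‖ < ε := by
  have h01 : (0 : ℝ) ≤ 1 := zero_le_one
  have hre : Continuous fun t : ℝ => (ζ (projIcc 0 1 h01 t)).re :=
    Complex.continuous_re.comp (ζ.continuous.comp continuous_projIcc)
  have him : Continuous fun t : ℝ => (ζ (projIcc 0 1 h01 t)).im :=
    Complex.continuous_im.comp (ζ.continuous.comp continuous_projIcc)
  obtain ⟨P, hP⟩ := exists_polynomial_near_of_continuousOn 0 1 _ hre.continuousOn (ε / 3)
    (by positivity)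
  obtain ⟨Q, hQ⟩ := exists_polynomial_near_of_continuousOn 0 1 _ him.continuousOn (ε / 3)
    (by positivity)
  let c : ℝ → ℂ := fun t => Complex.equivRealProdCLM.symm (P.eval t, Q.eval t)
  have hc : ContDiff ℝ 1 c :=
    Complex.equivRealProdCLM.symm.contDiff.comp ((P.contDiff_aeval (𝕜 := ℝ) 1).prodMk
      (Q.contDiff_aeval (𝕜 := ℝ) 1))
  -- A `C¹` curve in the plane misses a dense set of points, hence some `v` near the origin;
  -- translating by `-v` moves the curve off the origin.
  have hd := hc.dense_compl_range_of_finrank_lt_finrank (by simp)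
  obtain ⟨v, hv, hvε⟩ := hd.exists_dist_lt 0 (ε := ε / 3) (by positivity)
  rw [dist_zero_left] at hvε
  refine ⟨⟨fun t => c t - v, by
    have := hc.continuous
    fun_prop⟩, fun t => ⟨fun h => hv ⟨t, sub_eq_zero.1 h⟩, ?_⟩⟩
  have e1 := hP t t.2
  have e2 := hQ t t.2
  simp only [projIcc_val] at e1 e2
  have e3 : ‖c t - ζ t‖ ≤ |P.eval (t : ℝ) - (ζ t).re| + |Q.eval (t : ℝ) - (ζ t).im| := by
    simpa [c] using Complex.norm_le_abs_re_add_abs_im (c t - ζ t)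
  calc ‖c t - v - ζ t‖ = ‖(c t - ζ t) - v‖ := by congr 1; ring
    _ ≤ ‖c t - ζ t‖ + ‖v‖ := norm_sub_le _ _
    _ < ε := by linarith

/-- The `z`-coordinate of a path can be moved, where `‖z‖ < ‖w‖`, to have norm `‖w‖`. -/
theorem exists_norm_eq_max (z w : C(unitInterval, ℂ)) (hne : ∀ t, (z t, w t) ≠ 0) :
    ∃ ζ : C(unitInterval, ℂ), (∀ t, ‖ζ t‖ = max ‖z t‖ ‖w t‖) ∧
      ∀ t, ‖w t‖ ≤ ‖z t‖ → ζ t = z t := by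
  obtain ⟨t₀, -, ht₀⟩ := isCompact_univ.exists_isMinOn univ_nonempty
    (show Continuous fun t => max ‖z t‖ ‖w t‖ by fun_prop).continuousOn
  obtain ⟨ε, hε, hm⟩ : ∃ ε > 0, ∀ t, 4 * ε ≤ max ‖z t‖ ‖w t‖ := by
    refine ⟨max ‖z t₀‖ ‖w t₀‖ / 4, ?_, fun t => ?_⟩
    · have : 0 < max ‖z t₀‖ ‖w t₀‖ := by
        by_contra h
        have h1 := max_le_iff.1 (not_lt.1 h)
        exact hne t₀ (Prod.ext (norm_le_zero_iff.1 h1.1) (norm_le_zero_iff.1 h1.2))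
      positivity
    · have := isMinOn_iff.1 ht₀ t (mem_univ t)
      linarith
  obtain ⟨p, hp⟩ := exists_approx_ne_zero z hε
  -- Cutoff equal to 1 for `‖z‖ ≤ 2ε` and 0 for `‖z‖ ≥ 4ε`. It replaces `z` by `p` near zeros of
  -- `z`, and changes nothing where `‖w‖ ≤ ‖z‖`, since there `‖z‖ ≥ 4ε`.
  let χ : unitInterval → ℝ := fun t => max 0 (min 1 (2 - ‖z t‖ / (2 * ε)))
  have hχc : Continuous χ := by fun_prop
  have hχ0 : ∀ t, 0 ≤ χ t := fun t => le_max_left _ _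
  have hχ1 : ∀ t, χ t ≤ 1 := fun t => max_le zero_le_one (min_le_left _ _)
  let y : unitInterval → ℂ := fun t => z t + χ t • (p t - z t)
  have hyc : Continuous y := by fun_prop
  have hy0 : ∀ t, y t ≠ 0 := by
    intro t ht
    rcases le_total ‖z t‖ (2 * ε) with h | h
    · have h1 : ‖z t‖ / (2 * ε) ≤ 1 := (div_le_one (by positivity)).2 h
      have h2 : χ t = 1 := by
        simp only [χ]
        rw [min_eq_left (by linarith), max_eq_right zero_le_one]
      have h3 : y t = p t := by simp [y, h2]
      exact (hp t).1 (h3.symm.trans ht)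
    · have h1 : z t = -(χ t • (p t - z t)) := eq_neg_of_add_eq_zero_left ht
      have h2 : ‖z t‖ ≤ ‖p t - z t‖ := by
        calc ‖z t‖ = χ t * ‖p t - z t‖ := by
              conv_lhs => rw [h1]
              rw [norm_neg, norm_smul, Real.norm_of_nonneg (hχ0 t)]
          _ ≤ ‖p t - z t‖ := mul_le_of_le_one_left (norm_nonneg _) (hχ1 t)
      linarith [(hp t).2]
  have hyz : ∀ t, ‖w t‖ ≤ ‖z t‖ → y t = z t := by
    intro t ht
    have h1 := hm t
    rw [max_eq_left ht] at h1
    have h2 : 2 ≤ ‖z t‖ / (2 * ε) := by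
      rw [le_div_iff₀ (by positivity)]
      linarith
    have h3 : χ t = 0 := max_eq_left ((min_le_right _ _).trans (by linarith))
    simp [y, h3]
  refine ⟨⟨fun t => (max ‖z t‖ ‖w t‖ / ‖y t‖) • y t, ?_⟩, fun t => ?_, fun t ht => ?_⟩
  · exact (Continuous.div (by fun_prop) (by fun_prop) fun t => norm_ne_zero_iff.2 (hy0 t)).smul hyc
  · have h1 : 0 ≤ max ‖z t‖ ‖w t‖ / ‖y t‖ := by positivity
    change ‖(max ‖z t‖ ‖w t‖ / ‖y t‖) • y t‖ = _
    rw [norm_smul, Real.norm_of_nonneg h1, div_mul_cancel₀ _ (norm_ne_zero_iff.2 (hy0 t))]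
  · change (max ‖z t‖ ‖w t‖ / ‖y t‖) • y t = z t
    have h1 : ‖z t‖ ≠ 0 := hyz t ht ▸ norm_ne_zero_iff.2 (hy0 t)
    rw [max_eq_left ht, hyz t ht, div_self h1, one_smul]

/-- The complement of a knot in the interior of a standard solid torus has the fundamental group
generated by loops in the solid torus. -/
theorem IsSolidTorusCoords.surjective_map_inclusion {V K : Set S3} {z w : S3 → ℂ}
    {M : ℂ → ℂ → S3} (h : IsSolidTorusCoords V z w M) (hK : K ⊆ interior V)
    (x : ↥(V ∩ Kᶜ)) :
    Function.Surjective (FundamentalGroup.map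
      (ContinuousMap.inclusion (inter_subset_right : V ∩ Kᶜ ⊆ Kᶜ)) x) := by
  refine _root_.surjective_map_inclusion _ x fun γ hγ h0 h1 => ?_
  obtain ⟨ζ, hζ, hζz⟩ := exists_norm_eq_max ⟨fun t => z (γ t), h.continuous_z.comp γ.continuous⟩
    ⟨fun t => w (γ t), h.continuous_w.comp γ.continuous⟩ fun t => h.ne_zero (γ t)
  simp only [ContinuousMap.coe_mk] at hζ hζz
  -- Only the `z`-coordinate moves, linearly towards `ζ`. Points of `V` stay fixed; points outside
  -- keep `‖L‖ ≤ ‖w‖`, so they never enter the interior of `V` and avoid `K`, and they end on the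
  -- boundary torus.
  let L : unitInterval × unitInterval → ℂ := fun q =>
    (1 - (q.1 : ℝ)) • z (γ q.2) + (q.1 : ℝ) • ζ q.2
  have hL : ∀ q : unitInterval × unitInterval, ‖w (γ q.2)‖ ≤ ‖z (γ q.2)‖ → L q = z (γ q.2) := by
    intro q hq
    simp only [L]
    rw [hζz q.2 hq, ← add_smul, sub_add_cancel, one_smul]
  have hL' : ∀ q : unitInterval × unitInterval, ‖z (γ q.2)‖ ≤ ‖w (γ q.2)‖ →
      ‖L q‖ ≤ ‖w (γ q.2)‖ := by
    intro q hq
    have e1 : ‖ζ q.2‖ = ‖w (γ q.2)‖ := by rw [hζ, max_eq_right hq]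
    calc ‖L q‖ ≤ ‖(1 - (q.1 : ℝ)) • z (γ q.2)‖ + ‖(q.1 : ℝ) • ζ q.2‖ := norm_add_le _ _
      _ = (1 - (q.1 : ℝ)) * ‖z (γ q.2)‖ + (q.1 : ℝ) * ‖w (γ q.2)‖ := by
        rw [norm_smul, norm_smul, Real.norm_of_nonneg (sub_nonneg.2 q.1.2.2),
          Real.norm_of_nonneg q.1.2.1, e1]
      _ ≤ ‖w (γ q.2)‖ := by nlinarith [q.1.2.1, q.1.2.2]
  have hw0 : ∀ t, ‖z (γ t)‖ < ‖w (γ t)‖ → w (γ t) ≠ 0 := fun t ht =>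
    norm_pos_iff.1 ((norm_nonneg _).trans_lt ht)
  have hfix : ∀ q : unitInterval × unitInterval, γ q.2 ∈ V → M (L q) (w (γ q.2)) = γ q.2 := by
    intro q hq
    rw [hL q ((h.mem_iff _).1 hq), h.M_coords]
  have hLc : Continuous L := by
    have := h.continuous_z
    fun_prop
  refine ⟨fun q => M (L q) (w (γ q.2)), ?_, fun q => ?_, fun t => ?_, fun t => ?_,
    fun s => ?_, fun s => ?_⟩
  · refine h.continuousOn_M.comp_continuous (f := fun q => (L q, w (γ q.2)))
      (hLc.prodMk (h.continuous_w.comp (γ.continuous.comp continuous_snd))) fun q hq => ?_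
    rcases le_or_gt ‖w (γ q.2)‖ ‖z (γ q.2)‖ with hle | hlt
    · rw [hL q hle] at hq
      exact h.ne_zero _ hq
    · exact hw0 _ hlt (congrArg Prod.snd hq)
  · rcases le_or_gt ‖w (γ q.2)‖ ‖z (γ q.2)‖ with hle | hlt
    · change M (L q) (w (γ q.2)) ∈ Kᶜ
      rw [hfix q ((h.mem_iff _).2 hle)]
      exact hγ q.2
    · exact fun hmem => h.M_notMem_interior (hw0 _ hlt) (hL' q hlt.le) (hK hmem)
  · simp [L, h.M_coords]
  · have hL1 : L (1, t) = ζ t := by simp [L]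
    dsimp only
    rcases le_or_gt ‖w (γ t)‖ ‖z (γ t)‖ with hle | hlt
    · rw [hfix (1, t) ((h.mem_iff _).2 hle)]
      exact ⟨(h.mem_iff _).2 hle, hγ t⟩
    · have hζw : ‖ζ t‖ = ‖w (γ t)‖ := by rw [hζ, max_eq_right hlt.le]
      rw [hL1]
      refine ⟨h.M_mem ?_ hζw.ge, fun hmem => ?_⟩
      · rw [← norm_ne_zero_iff, hζw, norm_ne_zero_iff]
        exact hw0 _ hlt
      · exact h.M_notMem_interior (hw0 _ hlt) hζw.le (hK hmem)
  · have := hfix (s, 0) (by simp only [h0]; exact x.2.1)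
    exact this.trans h0
  · have := hfix (s, 1) (by simp only [h1]; exact x.2.1)
    exact this.trans h1

/-! ### Knot groups under change of tubular neighbourhood -/

namespace IsTubularChart

variable {τ : Circle × ℂ → S3} {V K : Set S3} (h : IsTubularChart τ V K)

include h

theorem compl_interior_subset : (interior V)ᶜ ⊆ Kᶜ :=
  compl_subset_compl.2 h.core_subset_interior

theorem continuous_radialPush_comp {Y : Type*} [TopologicalSpace Y] {t : Y → ℝ} {x : Y → S3}
    (ht : Continuous t) (hx : Continuous x) (hK : ∀ y, x y ∉ K) :
    Continuous fun y => radialPush τ V (t y) (x y) :=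
  h.continuousOn_radialPush.comp_continuous (f := fun y => (t y, x y)) (ht.prodMk hx)
    fun y => ⟨mem_univ _, hK y⟩

/-- The inclusion of the exterior into the knot complement. -/
abbrev exteriorInclusion : C(Exterior V, ↥Kᶜ) :=
  ContinuousMap.inclusion h.compl_interior_subset

/-- The retraction of the knot complement to the exterior. -/
noncomputable def retraction : C(↥Kᶜ, Exterior V) where
  toFun x := ⟨radialPush τ V 1 x, h.radialPush_one_notMem_interior x.2⟩
  continuous_toFun := (h.continuous_radialPush_comp continuous_const continuous_subtype_val
    fun x => x.2).subtype_mk _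

theorem surjective_map_exteriorInclusion (x : Exterior V) :
    Function.Surjective (FundamentalGroup.map h.exteriorInclusion x) := by
  refine surjective_map_inclusion _ x fun γ hγ h0 h1 =>
    ⟨fun q => radialPush τ V q.1 (γ q.2), ?_, fun q => ?_, fun t => ?_, fun t => ?_,
      fun s => ?_, fun s => ?_⟩
  · exact h.continuous_radialPush_comp (by fun_prop) (by fun_prop) fun q => hγ q.2
  · exact h.radialPush_notMem_core q.1.2 (hγ q.2)
  · simp [h.radialPush_zero]
  · simpa using h.radialPush_one_notMem_interior (hγ t)
  · simp only [h0]
    exact h.radialPush_of_notMem_interior _ x.2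
  · simp only [h1]
    exact h.radialPush_of_notMem_interior _ x.2

/-- At a base point of the exterior the retraction has the inclusion as a right inverse; any other
base point is joined to such a point by its radial path. -/
theorem surjective_map_retraction (y : ↥Kᶜ) :
    Function.Surjective (FundamentalGroup.map h.retraction y) := by
  have h1 : Function.Surjective
      (FundamentalGroup.map h.retraction (h.exteriorInclusion (h.retraction y))) := by
    refine surjective_map_of_comp (surjective_map_of_eq_id ?_ _)
    ext1 x
    exact Subtype.ext (h.radialPush_of_notMem_interior 1 x.2)
  let p : Path y (h.exteriorInclusion (h.retraction y)) :=
    { toFun := fun t => ⟨radialPush τ V t y, h.radialPush_notMem_core t.2 y.2⟩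
      continuous_toFun := (h.continuous_radialPush_comp (by fun_prop) continuous_const
        fun _ => y.2).subtype_mk _
      source' := Subtype.ext (by simp [h.radialPush_zero])
      target' := rfl }
  exact surjective_map_of_path p.symm h1

theorem exists_radius {W : Set S3} (hW : IsOpen W) (hK : K ⊆ W) :
    ∃ ε > 0, ∀ p : Circle × ℂ, ‖p.2‖ ≤ ε → τ p ∈ W := by
  obtain ⟨u, v, -, hv, hu, h0, huv⟩ := generalized_tube_lemma (isCompact_univ (X := Circle))
    (isCompact_singleton (x := (0 : ℂ))) (hW.preimage h.continuous) (by
      rintro p ⟨-, hp⟩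
      exact hK (h.mem_core.2 hp))
  obtain ⟨ε, hε, hball⟩ := Metric.isOpen_iff.1 hv 0 (h0 rfl)
  refine ⟨ε / 2, by positivity, fun p hp => huv ⟨hu (mem_univ _), hball ?_⟩⟩
  rw [mem_ball_zero_iff]
  linarith

theorem pathConnectedSpace_frontier : PathConnectedSpace ↥(frontier V) := by
  have hs : Function.Surjective (h.boundaryTorus ∘ Prod.map expMap expMap) :=
    h.boundaryTorus.surjective.comp
      (isOpenQuotientMap_expMap.surjective.prodMap isOpenQuotientMap_expMap.surjective)
  exact hs.pathConnectedSpace (h.boundaryTorus.continuous.comp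
    (expMap.continuous.prodMap expMap.continuous))

/-- The boundary torus shrunk by the factor `ε`, in the knot complement. -/
noncomputable def shrink {ε : ℝ} (hε : 0 < ε) : C(↥(frontier V), ↥Kᶜ) where
  toFun y := ⟨τ ((h.boundaryTorus.symm y).1, ε • ((h.boundaryTorus.symm y).2 : ℂ)), fun hy =>
    smul_ne_zero hε.ne' (Circle.coe_ne_zero _) (h.mem_core.1 hy)⟩
  continuous_toFun := by
    refine Continuous.subtype_mk (h.continuous.comp ?_) _
    have := h.boundaryTorus.symm.continuous
    have := isEmbedding_circle_coe.continuous
    fun_prop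

theorem shrink_mem {ε : ℝ} (hε : 0 < ε) {W : Set S3}
    (hW : ∀ p : Circle × ℂ, ‖p.2‖ ≤ ε → τ p ∈ W) (y : ↥(frontier V)) :
    (h.shrink hε y : S3) ∈ W := by
  refine hW _ ?_
  rw [norm_smul, Circle.norm_coe, mul_one, Real.norm_of_nonneg hε.le]

/-- The radial homotopy from the boundary torus to the shrunken torus. -/
noncomputable def shrinkHomotopy {ε : ℝ} (hε : 0 < ε) :
    (h.exteriorInclusion.comp (boundaryInclusion V)).Homotopy (h.shrink hε) where
  toFun q := ⟨τ ((h.boundaryTorus.symm q.2).1,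
    ((1 - q.1) + q.1 * ε : ℝ) • ((h.boundaryTorus.symm q.2).2 : ℂ)), fun hy => by
      refine smul_ne_zero ?_ (Circle.coe_ne_zero _) (h.mem_core.1 hy)
      rcases q.1.2.2.eq_or_lt with h1 | h1
      · simp [h1, hε.ne']
      · have := mul_nonneg q.1.2.1 hε.le
        exact (by linarith : 0 < 1 - (q.1 : ℝ) + q.1 * ε).ne'⟩
  continuous_toFun := by
    refine Continuous.subtype_mk (h.continuous.comp ?_) _
    have := h.boundaryTorus.symm.continuous
    have := isEmbedding_circle_coe.continuous
    fun_prop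
  map_zero_left y := by
    apply Subtype.ext
    have : (h.boundaryTorus (h.boundaryTorus.symm y) : S3) = y := by simp
    rw [h.boundaryTorus_apply] at this
    refine Eq.trans ?_ this
    simp
  map_one_left y := by
    apply Subtype.ext
    simp [shrink]

end IsTubularChart

/-- A self-map of the 3-sphere that restricts to a map of knot complements, surjective on
fundamental groups at points near the first knot, induces an epimorphism of knot groups that
preserves the peripheral structure. -/
theorem exists_epimorphism_preservesPeripheral {τ₁ τ₂ : Circle × ℂ → S3} {V₁ V₂ K₁ K₂ : Set S3}
    (h₁ : IsTubularChart τ₁ V₁ K₁) (h₂ : IsTubularChart τ₂ V₂ K₂) {F : C(S3, S3)}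
    (hF : ∀ x, F x ∈ K₂ ↔ x ∈ K₁) (FK : C(↥K₁ᶜ, ↥K₂ᶜ)) (hFK : ∀ x, (FK x : S3) = F x)
    {U : Set S3} (hU : IsOpen U) (hKU : K₁ ⊆ U)
    (hsurj : ∀ x : ↥K₁ᶜ, (x : S3) ∈ U → Function.Surjective (FundamentalGroup.map FK x))
    (x₁ : ↥(frontier V₁)) (x₂ : ↥(frontier V₂)) :
    ∃ φ : KnotGroup V₁ x₁ →* KnotGroup V₂ x₂, Function.Surjective φ ∧
      PreservesPeripheral (peripheralSubgroup V₁ x₁) (peripheralSubgroup V₂ x₂) φ := by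
  have hK₁ : K₁ ⊆ F ⁻¹' interior V₂ ∩ U := fun x hx =>
    ⟨h₂.core_subset_interior ((hF x).2 hx), hKU hx⟩
  -- The radius is so small that `F` maps the shrunken torus into `V₂`, whence the retraction sends
  -- it to the frontier of `V₂`, and that its points lie in `U`, where `hsurj` applies.
  obtain ⟨ε, hε, hεW⟩ := h₁.exists_radius ((isOpen_interior.preimage F.continuous).inter hU) hK₁
  let s := h₁.shrink hε
  have hs : ∀ y, (s y : S3) ∈ F ⁻¹' interior V₂ ∩ U := h₁.shrink_mem hε hεW
  let G : C(↥K₁ᶜ, Exterior V₂) := h₂.retraction.comp FK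
  let G' : C(↥(frontier V₁), ↥(frontier V₂)) :=
    { toFun := fun y => ⟨G (s y), h₂.radialPush_one_mem_frontier (FK (s y)).2 (by
        rw [hFK]
        exact interior_subset (hs y).1)⟩
      continuous_toFun := by fun_prop }
  -- This factorization through the boundary torus gives the peripheral condition. The base-point
  -- path `q` also runs inside the torus, so the conjugating element can be 1.
  have hG : G.comp s = (boundaryInclusion V₂).comp G' := rfl
  have := h₂.pathConnectedSpace_frontier
  let q : Path (G' x₁) x₂ := PathConnectedSpace.somePath _ _
  let q' : Path (G (s x₁)) (boundaryInclusion V₂ x₂) := q.map (boundaryInclusion V₂).continuous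
  let p : Path (h₁.exteriorInclusion (boundaryInclusion V₁ x₁)) (s x₁) :=
    (h₁.shrinkHomotopy hε).evalAt x₁
  let e₁ := FundamentalGroup.fundamentalGroupMulEquivOfPath p
  let e₂ := FundamentalGroup.fundamentalGroupMulEquivOfPath q'
  have hGs : Function.Surjective (FundamentalGroup.map G (s x₁)) := by
    intro γ
    obtain ⟨β, rfl⟩ := h₂.surjective_map_retraction (FK (s x₁)) γ
    obtain ⟨α, rfl⟩ := hsurj (s x₁) (hs x₁).2 β
    exact ⟨α, fundamentalGroup_map_comp _ _ _ α⟩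
  refine ⟨e₂.toMonoidHom.comp ((FundamentalGroup.map G (s x₁)).comp
    (e₁.toMonoidHom.comp (FundamentalGroup.map h₁.exteriorInclusion (boundaryInclusion V₁ x₁)))),
    ?_, 1, ?_⟩
  · exact e₂.surjective.comp (hGs.comp (e₁.surjective.comp
      (h₁.surjective_map_exteriorInclusion _)))
  · rintro _ ⟨γ, rfl⟩
    rw [one_mul, inv_one, mul_one]
    refine ⟨FundamentalGroup.fundamentalGroupMulEquivOfPath q
      (FundamentalGroup.map G' x₁ γ), ?_⟩
    have e1 := fundamentalGroup_map_of_homotopy (h₁.shrinkHomotopy hε) x₁ γ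
    rw [fundamentalGroup_map_comp] at e1
    have e2 := fundamentalGroup_map_comp G s x₁ γ
    have e3 := fundamentalGroup_map_comp (boundaryInclusion V₂) G' x₁ γ
    rw [fundamentalGroup_map_basepoint, ← e3]
    change _ = e₂ (FundamentalGroup.map G (s x₁) (e₁ _))
    refine congrArg e₂ (e2.trans ?_)
    exact congrArg _ e1

theorem proposition3p4 (k kt : Knot) (hk : IsSatelliteWithPattern k kt) : k ⪰ kt := by
  obtain ⟨S⟩ := hk
  intro V₁ V₂ hV₁ hV₂ x₁ x₂
  obtain ⟨τ₁, h₁⟩ := hV₁.exists_isTubularChart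
  obtain ⟨τ₂, h₂⟩ := hV₂.exists_isTubularChart
  obtain ⟨z, w, M, hc⟩ := S.isStandardSolidTorus.exists_coords
  obtain ⟨F, hFg, hF⟩ := S.exists_collapse
  have hgc := S.isLocalDiffeomorphOn.contMDiffOn.continuousOn
  let FK : C(↥k.carrierᶜ, ↥kt.carrierᶜ) :=
    { toFun := fun x => ⟨F x, fun hx => x.2 ((hF x).1 hx)⟩
      continuous_toFun := by fun_prop }
  let g' : C(↥(S.Vt ∩ kt.carrierᶜ), ↥k.carrierᶜ) :=
    { toFun := fun x => ⟨S.g x, fun hx => x.2.2 (by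
        have := (hF _).2 hx
        rwa [hFg x x.2.1] at this)⟩
      continuous_toFun := Continuous.subtype_mk
        (hgc.comp_continuous continuous_subtype_val fun x => x.2.1) _ }
  -- Since the inclusion is surjective on fundamental groups, so is `FK` at every base point in the
  -- image of `g'`, in particular at those in the interior of `Vh`.
  have hcomp : FK.comp g' = ContinuousMap.inclusion inter_subset_right := by
    ext1 x
    exact Subtype.ext (hFg x x.2.1)
  refine exists_epimorphism_preservesPeripheral h₁ h₂ hF FK (fun _ => rfl)
    (isOpen_interior (s := S.Vh)) ?_ ?_ x₁ x₂
  · rw [← S.satellite_eq]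
    exact (image_mono S.pattern_subset).trans S.image_interior_subset
  · rintro ⟨x, hx⟩ hxU
    have hxV : x ∈ S.g '' S.Vt := S.image_eq.symm ▸ interior_subset hxU
    obtain ⟨y, hy, rfl⟩ := hxV
    have hyK : y ∉ kt.carrier := fun h => hx ((hF _).1 (by rwa [hFg y hy]))
    have hs := hc.surjective_map_inclusion S.pattern_subset ⟨y, hy, hyK⟩
    rw [← hcomp] at hs
    exact surjective_map_of_comp hs
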